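/- Let $d\ge 1$ and let $M$ be a measurable space (the space of marks). A marked configuration is a countable collection (with multiplicities) $\boldsymbol x=\{(x_i,p_i)\}_{i\in I}$ of points of $\mathbb R^d\times M$ having finitely many points in $B\times M$ for every bounded $B\subset\mathbb R^d$; it is identified with the counting measure $\sum_{i\in I}\delta_{(x_i,p_i)}$, and the space of configurations carries the evaluation $\sigma$-algebra. A marked point process $\mathbf X$ is a random marked configuration, on some probability space $(\Omega,\mathcal F,\mathbb P)$. An $\mathbf X$-point is a random element $\mathbf z$ of $\mathbb R^d\times M$ on the same probability space with $\mathbf z\in\mathbf X$ (i.e. $\delta_{\mathbf z}\le\mathbf X$) almost surely, and $\mathbf X$ is deletion-tolerant if for every $\mathbf X$-point $\mathbf z$ the law of $\mathbf X\setminus\{\mathbf z\}$ (i.e. of $\mathbf X-\delta_{\mathbf z}$) is absolutely continuous with respect to the law of $\mathbf X$. (a) Every i.i.d.-marked Cox point process $\mathbf X$ on $\mathbb R^d\times M$ is deletion-tolerant. Here $\mathbf X$ is i.i.d.-marked if it is distributed as $\{(X_i,P_i)\}_{i\in I}$ with marks $P_i$ that are i.i.d. and independent of the index set $I$ and the locations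 $X_i$; it is a Cox process if its process of locations is, conditionally on some random locally finite measure $\Gamma$ on $\mathbb R^d$, a Poisson point process with intensity measure $\Gamma$. (b) Let $M$ be a Polish space with its Borel $\sigma$-algebra, let $\lambda>0$, let $Q$ be a probability measure on $M$, and for bounded measurable $\Lambda\subset\mathbb R^d$ let $\mathcal P_\Lambda$ be the law of the Poisson point process on $\Lambda\times M$ with intensity $\lambda\,\mathrm dv\otimes Q$ (the homogeneous Poisson point process in $\Lambda$ with i.i.d. marks of law $Q$). Let $H$ be a Hamiltonian, i.e. a measurable function of configurations with values in $(-\infty,\infty]$. Write $\boldsymbol y_{\Lambda}=\{(v,q)\in\boldsymbol y: v\in\Lambda\}$, $\Lambda^{\rm c}=\mathbb R^d\setminus\Lambda$, and $$H_\Lambda(\boldsymbol x)=\limsup_{n\to\infty}\big(H(\boldsymbol x_{\Delta_n})-H(\boldsymbol x_{\Delta_n\setminus\Lambda})\big),\qquad \Delta_n=\{v\in\mathbb R^d:\|v\|_2<n\},\qquad \infty-\infty:=0,$$ for the local energy, and $$Z_\Lambda(\boldsymbol y)=\int\mathcal P_\Lambda(\mathrm d\boldsymbol x)\exp\big(-H_\Lambda(\boldsymbol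 x\cup\boldsymbol y_{\Lambda^{\rm c}})\big)\in[0,\infty].$$ A marked point process $\mathbf X$ is an infinite-volume Gibbs point process for $H$ if for all bounded measurable $\Lambda$ and all measurable sets $\mathcal A$ of configurations $$\mathbb P(\mathbf X\in\mathcal A)=\mathbb E\Big[\frac1{Z_\Lambda(\mathbf X)}\int\mathcal P_\Lambda(\mathrm d\boldsymbol x)\,\mathbf 1\{\boldsymbol x\cup\mathbf X_{\Lambda^{\rm c}}\in\mathcal A\}\exp\big(-H_\Lambda(\boldsymbol x\cup\mathbf X_{\Lambda^{\rm c}})\big)\Big].$$ If $\mathbf X$ is such a Gibbs point process and, for every bounded measurable $\Lambda\subset\mathbb R^d$, $Z_\Lambda(\mathbf X)<\infty$ almost surely, then $\mathbf X$ is deletion-tolerant. -/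

import Mathlib

open MeasureTheory ProbabilityTheory Set Filter
open scoped ENNReal NNReal Nat

noncomputable section

namespace PointProc

/-- The location space `ℝ^d`. -/
abbrev Loc (d : ℕ) : Type := EuclideanSpace ℝ (Fin d)

/-- `ξ` is a locally finite configuration of marked points `(xᵢ, pᵢ)`, `i ∈ I`, in `ℝ^d × M`,
encoded by its counting measure `∑ᵢ δ_(xᵢ, pᵢ)`. Local finiteness refers to the locations.
The space `Measure (Loc d × M)` carries the evaluation σ-algebra, generated by `ξ ↦ ξ B`. -/
def IsConfig {d : ℕ} {M : Type*} [MeasurableSpace M] (ξ : Measure (Loc d × M)) : Prop :=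
  (∃ (I : Set ℕ) (x : I → Loc d × M), ξ = Measure.sum fun i => Measure.dirac (x i)) ∧
    ∀ B : Set (Loc d), Bornology.IsBounded B → ξ (B ×ˢ univ) < ∞

/-- The part `ξ_Λ` of a marked configuration with locations in `Λ`. -/
def restr {d : ℕ} {M : Type*} [MeasurableSpace M] (Λ : Set (Loc d)) (ξ : Measure (Loc d × M)) :
    Measure (Loc d × M) :=
  ξ.restrict (Λ ×ˢ univ)

section Deletion

variable {d : ℕ} {M Ω : Type*} [MeasurableSpace M] [MeasurableSpace Ω]

/-- A marked point process in `ℝ^d × M`: a random locally finite configuration. -/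
def IsMarkedPointProcess (P : Measure Ω) (X : Ω → Measure (Loc d × M)) : Prop :=
  Measurable X ∧ ∀ᵐ ω ∂P, IsConfig (X ω)

/-- `z` is an `X`-point: a random element of `ℝ^d × M` on the same probability space with `z ∈ X`
almost surely. For counting measures, `z ∈ X` means `δ_z ≤ X`. -/
def IsPointOf (P : Measure Ω) (X : Ω → Measure (Loc d × M)) (z : Ω → Loc d × M) : Prop :=
  Measurable z ∧ ∀ᵐ ω ∂P, Measure.dirac (z ω) ≤ X ω

/-- `X` is deletion-tolerant: for every `X`-point `z`, the law of `X ∖ {z}` (the configuration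
`X - δ_z`) is absolutely continuous with respect to the law of `X`. -/
def DeletionTolerant (P : Measure Ω) (X : Ω → Measure (Loc d × M)) : Prop :=
  ∀ z : Ω → Loc d × M, IsPointOf P X z →
    ∀ A : Set (Measure (Loc d × M)), MeasurableSet A →
      P {ω | X ω ∈ A} = 0 → P {ω | X ω - Measure.dirac (z ω) ∈ A} = 0

end Deletion

/-- The law of the Poisson point process with finite intensity measure `ν`: the number `n` of
points is Poisson distributed with parameter `m = ν(S)`, and given `n` the points are independent
with law `ν / m`; thus the part with `n` points is `e^{-m} / n!` times the image of `ν^{⊗n}` under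
`(x₁, …, xₙ) ↦ ∑ᵢ δ_{xᵢ}`. -/
def poissonLaw {S : Type*} [MeasurableSpace S] (ν : Measure S) : Measure (Measure S) :=
  Measure.sum fun n : ℕ =>
    (ENNReal.ofReal (Real.exp (-(ν univ).toReal)) / (n ! : ℝ≥0∞)) •
      (Measure.pi fun _ : Fin n => ν).map fun x => ∑ i, Measure.dirac (x i)

section Cox

variable {d : ℕ} {M Ω : Type*} [MeasurableSpace M] [MeasurableSpace Ω]

/-- `Y` is a Cox point process on `ℝ^d`: for some random locally finite measure `Γ` (with law `θ`),
`Y` is conditionally on `Γ` a Poisson point process with intensity measure `Γ`, that is,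
in each bounded window `Λ` it is Poisson with intensity `Γ` restricted to `Λ`. -/
def IsCox (P : Measure Ω) (Y : Ω → Measure (Loc d)) : Prop :=
  ∃ θ : Measure (Measure (Loc d)), IsProbabilityMeasure θ ∧
    (∀ᵐ γ ∂θ, IsLocallyFiniteMeasure γ) ∧
    ∀ Λ : Set (Loc d), Bornology.IsBounded Λ → MeasurableSet Λ →
      ∀ A : Set (Measure (Loc d)), MeasurableSet A →
        P {ω | (Y ω).restrict Λ ∈ A} = ∫⁻ γ, poissonLaw (γ.restrict Λ) A ∂θ

/-- The marked configuration `∑_{i ∈ I} δ_(xᵢ, qᵢ)` with locations `xᵢ` and marks `qᵢ`. -/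
def attachMarks (c : (Set ℕ × (ℕ → Loc d)) × (ℕ → M)) : Measure (Loc d × M) :=
  Measure.sum fun i : c.1.1 => Measure.dirac (c.1.2 i, c.2 i)

/-- `X` is i.i.d.-marked: it is distributed as `∑_{i ∈ I} δ_(xᵢ, qᵢ)`, where the marks `qᵢ` are
i.i.d. with some law `Q` and independent of the (random) index set `I` and locations `xᵢ`. -/
def IsIIDMarked (P : Measure Ω) (X : Ω → Measure (Loc d × M)) : Prop :=
  ∃ (Q : Measure M) (ρ : Measure (Set ℕ × (ℕ → Loc d))),
    IsProbabilityMeasure Q ∧ IsProbabilityMeasure ρ ∧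
    P.map X = (ρ.prod (Measure.infinitePi fun _ : ℕ => Q)).map attachMarks

/-- An i.i.d.-marked Cox point process: an i.i.d.-marked point process whose process of locations
is a Cox point process. -/
def IsIIDMarkedCox (P : Measure Ω) (X : Ω → Measure (Loc d × M)) : Prop :=
  IsMarkedPointProcess P X ∧ IsIIDMarked P X ∧ IsCox P fun ω => (X ω).map Prod.fst

end Cox

section Gibbs

variable {d : ℕ} {M Ω : Type*} [MeasurableSpace M] [MeasurableSpace Ω]

/-- A Hamiltonian: a measurable energy in `(-∞, ∞]`. Only the energies of finite configurations
are ever used. -/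
structure Hamiltonian (d : ℕ) (M : Type*) [MeasurableSpace M] where
  /-- the energy of a configuration -/
  energy : Measure (Loc d × M) → EReal
  measurable_energy : Measurable energy
  energy_ne_bot : ∀ ξ, energy ξ ≠ ⊥

/-- The energy difference `a - b`, with the convention `∞ - ∞ = 0`. -/
def energyDiff (a b : EReal) : EReal := if a = b then 0 else a - b

/-- The local energy `H_Λ(ξ) = lim_n (H(ξ_{Δₙ}) - H(ξ_{Δₙ ∖ Λ}))` of `ξ` in `Λ`, where `Δₙ` is
the ball of radius `n` around the origin. Taking the limit superior makes it defined everywhere;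
for interactions of finite range the sequence is eventually constant. -/
def Hamiltonian.localEnergy (H : Hamiltonian d M) (Λ : Set (Loc d))
    (ξ : Measure (Loc d × M)) : EReal :=
  limsup (fun n : ℕ => energyDiff (H.energy (restr (Metric.ball 0 n) ξ))
    (H.energy (restr (Metric.ball 0 n \ Λ) ξ))) atTop

/-- The law `𝒫_Λ` of the i.i.d.-marked homogeneous Poisson point process in `Λ`, with intensity
`lam` and mark law `Q`. -/
def refPoisson (lam : ℝ≥0) (Q : Measure M) (Λ : Set (Loc d)) : Measure (Measure (Loc d × M)) :=
  poissonLaw ((lam • (volume : Measure (Loc d)).restrict Λ).prod Q)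

/-- The partition function `Z_Λ(y) = ∫ 𝒫_Λ(dx) exp (-H_Λ(x ∪ y_{Λᶜ}))`, with values in `[0, ∞]`. -/
def partitionFunction (H : Hamiltonian d M) (lam : ℝ≥0) (Q : Measure M) (Λ : Set (Loc d))
    (y : Measure (Loc d × M)) : ℝ≥0∞ :=
  ∫⁻ x, EReal.exp (-H.localEnergy Λ (x + restr Λᶜ y)) ∂refPoisson lam Q Λ

/-- `X` is an infinite-volume Gibbs point process for `H`: it satisfies the DLR equations, that is,
for every bounded measurable `Λ`, conditionally on `X_{Λᶜ}` the law of `X_Λ` has density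
`exp (-H_Λ(· ∪ X_{Λᶜ})) / Z_Λ(X_{Λᶜ})` with respect to `𝒫_Λ`. -/
def IsGibbs (P : Measure Ω) (X : Ω → Measure (Loc d × M)) (H : Hamiltonian d M) (lam : ℝ≥0)
    (Q : Measure M) : Prop :=
  IsMarkedPointProcess P X ∧
    ∀ Λ : Set (Loc d), Bornology.IsBounded Λ → MeasurableSet Λ →
      ∀ A : Set (Measure (Loc d × M)), MeasurableSet A →
        P {ω | X ω ∈ A} = ∫⁻ ω, (partitionFunction H lam Q Λ (X ω))⁻¹ *
          ∫⁻ x, A.indicator (fun ξ => EReal.exp (-H.localEnergy Λ ξ)) (x + restr Λᶜ (X ω))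
            ∂refPoisson lam Q Λ ∂P

end Gibbs

end PointProc

end

open MeasureTheory ProbabilityTheory Set Filter
open scoped ENNReal NNReal Nat

noncomputable section

namespace PointProc

/-! ### Deletion of a point as a measurable operation -/

section General

variable {S : Type*} [MeasurableSpace S]

/-! In both parts an arbitrary choice of the deleted point is replaced by countably many operations
that do not depend on it, each of which preserves null events.

Gibbs case. A DLR law charges no configuration with two points at one location, since the Poisson
reference law does not. So every point is alone in one of countably many small windows, and deleting
it means emptying that window. Emptying a window `Λ` preserves null events: the reference process is
empty in `Λ` with positive probability, a configuration without points in `Λ` has local energy `0`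
and hence weight `1`, and `Z_Λ < ∞` keeps the prefactor positive (`IsGibbs.ae_restr_compl_notMem`).

Cox case. A point lies in some ball `W`, which contains finitely many points, so a uniformly chosen
point of `W` equals it with positive probability. It therefore suffices to treat uniform deletion
(`deletionTolerant_of_delMass`). For a Poisson process of intensity `ν`, Mecke's formula bounds the
law after uniform deletion by `ν W` times the original law (`lintegral_delMass_poissonLaw`). For a
Cox process `Γ W` is unbounded, but truncating at `Γ W ≤ c` costs only the small probability of `Γ W
> c` (`delLaw_cylinder_le`, `delLaw_eq_zero_of_cox`).

Marks are then added by Fubini. Given a null event, the probability that i.i.d. marks put an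
enumerated configuration into it does not depend on the enumeration (`infinitePi_zipMarks_eq`). By
Blackwell's theorem its positivity is an event `N` of location configurations
(`exists_measurableSet_of_pts_invariant`). This `N` is null, hence avoided also after deletion of a
location, and the remaining marks are still i.i.d. -/

/-- The space of set functions `B ↦ e B` on measurable sets. -/
abbrev SetFun (S : Type*) [MeasurableSpace S] : Type _ := {B : Set S // MeasurableSet B} → ℝ≥0∞

/-- A measure, viewed as the family of its values on measurable sets. -/
def evalMap (ξ : Measure S) : SetFun S := fun B => ξ B

lemma measurable_evalMap : Measurable (evalMap (S := S)) :=
  measurable_pi_lambda _ fun B => Measure.measurable_coe B.2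

/-- Events are recorded as sets of set functions because `delEval` is visibly measurable jointly in
the configuration and the point. Joint measurability of the measure-valued `ξ - δ_z` is then never
needed. -/
lemma exists_evalMap_preimage {A : Set (Measure S)} (hA : MeasurableSet A) :
    ∃ A' : Set (SetFun S), MeasurableSet A' ∧ evalMap ⁻¹' A' = A := by
  have h : (Measure.instMeasurableSpace : MeasurableSpace (Measure S)) ≤
      MeasurableSpace.comap evalMap inferInstance := by
    refine iSup₂_le fun B hB => ?_
    rw [← measurable_iff_comap_le]
    exact (measurable_pi_apply (X := fun _ : {B : Set S // MeasurableSet B} => ℝ≥0∞)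
      ⟨B, hB⟩).comp (comap_measurable _)
  obtain ⟨A', h1, h2⟩ := h A hA
  exact ⟨A', h1, h2⟩

/-- The values `ξ B - δ_z B` of the configuration `ξ` with the point `z` deleted. -/
def delEval (p : Measure S × S) : SetFun S := fun B => p.1 B - Measure.dirac p.2 (B : Set S)

lemma measurable_delEval : Measurable (delEval (S := S)) := by
  refine measurable_pi_lambda _ fun B => ?_
  refine ((Measure.measurable_coe B.2).comp measurable_fst).sub ?_
  exact (Measure.measurable_coe B.2).comp (Measure.measurable_dirac.comp measurable_snd)

lemma delEval_add_dirac (η : Measure S) (z : S) :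
    delEval (η + Measure.dirac z, z) = evalMap η := by
  funext B
  simp only [delEval, evalMap, Measure.add_apply]
  exact ENNReal.add_sub_cancel_right (measure_ne_top _ _)

lemma evalMap_sub_dirac {ξ : Measure S} {z : S} (h : Measure.dirac z ≤ ξ) :
    evalMap (ξ - Measure.dirac z) = delEval (ξ, z) := by
  funext B
  exact Measure.sub_apply B.2 h

/-- The kernel `ξ ↦ ξ(· | W)` choosing a uniform point of the configuration `ξ` in `W`. -/
def condKernel {W : Set S} (hW : MeasurableSet W) : Kernel (Measure S) S where
  toFun ξ := (ξ W)⁻¹ • ξ.restrict W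
  measurable' := by
    refine Measure.measurable_of_measurable_coe _ fun B hB => ?_
    simp only [Measure.smul_apply, Measure.restrict_apply hB, smul_eq_mul]
    exact (Measure.measurable_coe hW).inv.mul (Measure.measurable_coe (hB.inter hW))

lemma condKernel_univ_le {W : Set S} (hW : MeasurableSet W) (ξ : Measure S) :
    condKernel hW ξ univ ≤ 1 := by
  simp only [condKernel, Kernel.coe_mk, Measure.smul_apply, Measure.restrict_apply_univ,
    smul_eq_mul]
  exact ENNReal.inv_mul_le_one _

instance {W : Set S} (hW : MeasurableSet W) : IsFiniteKernel (condKernel hW) :=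
  ⟨⟨1, ENNReal.one_lt_top, condKernel_univ_le hW⟩⟩

/-- The probability that the deletion of a uniform point of `ξ` in `W` leads to the event `A`. -/
def delMass {W : Set S} (hW : MeasurableSet W) (A : Set (SetFun S)) (ξ : Measure S) : ℝ≥0∞ :=
  ∫⁻ z, A.indicator (fun _ => 1) (delEval (ξ, z)) ∂condKernel hW ξ

lemma measurable_delMass {W : Set S} (hW : MeasurableSet W) {A : Set (SetFun S)}
    (hA : MeasurableSet A) : Measurable (delMass hW A) := by
  have : Measurable fun p : Measure S × S =>
      A.indicator (fun _ => (1 : ℝ≥0∞)) (delEval p) :=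
    (measurable_const.indicator hA).comp measurable_delEval
  exact this.lintegral_kernel_prod_right'

lemma delMass_le_one {W : Set S} (hW : MeasurableSet W) (A : Set (SetFun S)) (ξ : Measure S) :
    delMass hW A ξ ≤ 1 := by
  refine le_trans (lintegral_mono (g := fun _ => 1) fun z => ?_) ?_
  · exact indicator_le_self' (fun _ _ => zero_le) _
  · simpa using condKernel_univ_le hW ξ

/-- The atom at `z` has mass at least `1 / ξ W` under the uniform choice, which is positive because
`ξ W` is finite. -/
lemma delMass_ne_zero {W : Set S} (hW : MeasurableSet W) {A : Set (SetFun S)}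
    (hA : MeasurableSet A) {ξ : Measure S} {z : S} (hz : Measure.dirac z ≤ ξ) (hzW : z ∈ W)
    (hξ : ξ W ≠ ∞) (h : delEval (ξ, z) ∈ A) : delMass hW A ξ ≠ 0 := by
  have hm : Measurable fun z : S => A.indicator (fun _ => (1 : ℝ≥0∞)) (delEval (ξ, z)) :=
    (measurable_const.indicator hA).comp (measurable_delEval.comp measurable_prodMk_left)
  have h1 : 1 ≤ ∫⁻ z, A.indicator (fun _ => (1 : ℝ≥0∞)) (delEval (ξ, z)) ∂ξ.restrict W := by
    calc (1 : ℝ≥0∞) = ∫⁻ z, A.indicator (fun _ => (1 : ℝ≥0∞)) (delEval (ξ, z))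
          ∂(Measure.dirac z).restrict W := by
          classical
          rw [restrict_dirac' hW, if_pos hzW, lintegral_dirac' _ hm, indicator_of_mem h]
      _ ≤ _ := lintegral_mono' (Measure.restrict_mono subset_rfl hz) le_rfl
  simp only [delMass, condKernel, Kernel.coe_mk, lintegral_smul_measure, smul_eq_mul]
  refine mul_ne_zero (ENNReal.inv_ne_zero.2 hξ) ?_
  exact (lt_of_lt_of_le one_pos h1).ne'

/-- Deletion from a configuration `∑ᵢ δ_{xᵢ}`, where `η i` is the configuration without `xᵢ`. -/
lemma delMass_eq_tsum {ι : Type*} [Countable ι] {W : Set S} (hW : MeasurableSet W)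
    {A : Set (SetFun S)} (hA : MeasurableSet A) {ξ : Measure S} (x : ι → S) (η : ι → Measure S)
    (hξ : ξ = Measure.sum fun i => Measure.dirac (x i))
    (hη : ∀ i, ξ = η i + Measure.dirac (x i)) :
    delMass hW A ξ = ∑' i, (ξ W)⁻¹ *
      (W.indicator (fun _ => 1) (x i) * (evalMap ⁻¹' A).indicator (fun _ => 1) (η i)) := by
  have hm : Measurable fun z : S => A.indicator (fun _ => (1 : ℝ≥0∞)) (delEval (ξ, z)) :=
    (measurable_const.indicator hA).comp (measurable_delEval.comp measurable_prodMk_left)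
  rw [ENNReal.tsum_mul_left]
  simp only [delMass, condKernel, Kernel.coe_mk, lintegral_smul_measure, smul_eq_mul]
  congr 1
  rw [← lintegral_indicator hW]
  conv_lhs => rw [hξ]
  rw [lintegral_sum_measure]
  refine tsum_congr fun i => ?_
  rw [← hξ, lintegral_dirac' _ (hm.indicator hW)]
  have : delEval (ξ, x i) = evalMap (η i) := by
    conv_lhs => rw [hη i]
    exact delEval_add_dirac _ _
  by_cases hx : x i ∈ W
  · simp only [indicator_of_mem hx, one_mul, this]
    rfl
  · simp [indicator_of_notMem hx]

end General

/-! ### Reduction to uniform deletion in balls -/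

section Reduction

variable {d : ℕ} {M Ω : Type*} [MeasurableSpace M] [MeasurableSpace Ω]

/-- The marked points with locations in the ball of radius `n` around the origin. -/
abbrev cyl (d : ℕ) (M : Type*) (n : ℕ) : Set (Loc d × M) := Metric.ball 0 n ×ˢ univ

lemma measurableSet_cyl (n : ℕ) : MeasurableSet (cyl d M n) :=
  measurableSet_ball.prod MeasurableSet.univ

/-- It suffices to delete a uniform point of each bounded window. -/
lemma deletionTolerant_of_delMass {P : Measure Ω} {X : Ω → Measure (Loc d × M)}
    (hX : IsMarkedPointProcess P X)
    (h : ∀ A : Set (SetFun (Loc d × M)), MeasurableSet A → P {ω | X ω ∈ evalMap ⁻¹' A} = 0 →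
      ∀ n : ℕ, ∀ᵐ ω ∂P, delMass (measurableSet_cyl (M := M) (d := d) n) A (X ω) = 0) :
    DeletionTolerant P X := by
  intro z hz A hA hPA
  obtain ⟨A', hA', rfl⟩ := exists_evalMap_preimage hA
  have h' := ae_all_iff.2 (h A' hA' hPA)
  suffices ∀ᵐ ω ∂P, ¬ (X ω - Measure.dirac (z ω) ∈ evalMap ⁻¹' A') by
    simpa [ae_iff] using this
  filter_upwards [h', hz.2, hX.2] with ω h1 h2 h3 h4
  obtain ⟨n, hn⟩ := exists_nat_gt ‖(z ω).1‖
  refine delMass_ne_zero (measurableSet_cyl (M := M) (d := d) n) hA' h2 ?_ ?_ ?_ (h1 n)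
  · simpa using hn
  · exact (h3.2 _ Metric.isBounded_ball).ne
  · rw [mem_preimage, evalMap_sub_dirac h2] at h4
    exact h4

end Reduction

/-! ### Finite Poisson processes and Mecke's formula -/

section Poisson

variable {S : Type*} [MeasurableSpace S]

lemma measurable_sum_dirac {ι : Type*} [Fintype ι] :
    Measurable fun x : ι → S => ∑ i, Measure.dirac (x i) := by
  refine Measure.measurable_of_measurable_coe _ fun B hB => ?_
  simp only [Measure.finsetSum_apply]
  exact Finset.measurable_sum _ fun i _ =>
    (Measure.measurable_coe hB).comp (Measure.measurable_dirac.comp (measurable_pi_apply i))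

/-- The weight `e^{-m} / n!`. -/
def poissonWeight (ν : Measure S) (n : ℕ) : ℝ≥0∞ :=
  ENNReal.ofReal (Real.exp (-(ν univ).toReal)) / (n ! : ℝ≥0∞)

lemma poissonWeight_zero_ne_zero (ν : Measure S) : poissonWeight ν 0 ≠ 0 := by
  simp [poissonWeight, Real.exp_pos]

lemma poissonWeight_succ (ν : Measure S) (n : ℕ) :
    poissonWeight ν (n + 1) * (n + 1 : ℕ) = poissonWeight ν n := by
  have h : ((n + 1 : ℕ) : ℝ≥0∞) ≠ 0 := by simp
  simp only [poissonWeight, Nat.factorial_succ, Nat.cast_mul, div_eq_mul_inv]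
  rw [ENNReal.mul_inv (Or.inl h) (Or.inl (ENNReal.natCast_ne_top _)), mul_comm _⁻¹, mul_assoc,
    mul_assoc, ENNReal.inv_mul_cancel h (ENNReal.natCast_ne_top _), mul_one]

lemma lintegral_poissonLaw (ν : Measure S) {F : Measure S → ℝ≥0∞} (hF : Measurable F) :
    ∫⁻ ξ, F ξ ∂poissonLaw ν = ∑' n : ℕ, poissonWeight ν n *
      ∫⁻ x, F (∑ i, Measure.dirac (x i)) ∂Measure.pi fun _ : Fin n => ν := by
  rw [poissonLaw, lintegral_sum_measure]
  refine tsum_congr fun n => ?_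
  rw [lintegral_smul_measure, lintegral_map hF measurable_sum_dirac]
  rfl

instance isProbabilityMeasure_poissonLaw (ν : Measure S) [IsFiniteMeasure ν] :
    IsProbabilityMeasure (poissonLaw ν) := by
  constructor
  rw [← lintegral_one, lintegral_poissonLaw ν measurable_const]
  simp only [lintegral_one, Measure.pi_univ, Finset.prod_const, Finset.card_univ, Fintype.card_fin]
  set r : ℝ := (ν univ).toReal with hr
  have hr0 : 0 ≤ r := ENNReal.toReal_nonneg
  have hν : ν univ = ENNReal.ofReal r := (ENNReal.ofReal_toReal (measure_ne_top _ _)).symm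
  have hs : HasSum (fun n : ℕ => Real.exp (-r) * r ^ n / n !) 1 := 
    hasSum_one_poissonMeasure ⟨r, hr0⟩
  have h1 : ∀ n : ℕ, poissonWeight ν n * ν univ ^ n =
      ENNReal.ofReal (Real.exp (-r) * r ^ n / n !) := by
    intro n
    have hn : (0 : ℝ) < n ! := by exact_mod_cast Nat.factorial_pos n
    rw [poissonWeight, ← hr, hν, ENNReal.ofReal_div_of_pos hn, ENNReal.ofReal_mul (Real.exp_pos _).le,
      ENNReal.ofReal_pow hr0, ENNReal.ofReal_natCast, div_eq_mul_inv, div_eq_mul_inv]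
    ring
  rw [tsum_congr h1, ← ENNReal.ofReal_tsum_of_nonneg _ hs.summable, hs.tsum_eq, ENNReal.ofReal_one]
  intro n
  positivity

lemma poissonLaw_empty_pos (ν : Measure S) [SigmaFinite ν] :
    poissonLaw ν {ξ | ξ univ = 0} ≠ 0 := by
  have hm : MeasurableSet {ξ : Measure S | ξ univ = 0} :=
    Measure.measurable_coe MeasurableSet.univ (measurableSet_singleton 0)
  intro h
  rw [← lintegral_indicator_one hm, lintegral_poissonLaw ν (measurable_one.indicator hm),
    ENNReal.tsum_eq_zero] at h
  have h0 := (mul_eq_zero.1 (h 0)).resolve_left (poissonWeight_zero_ne_zero ν)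
  simp [indicator] at h0

lemma poissonLaw_null (ν : Measure S) {T : Set (Measure S)} (hT : MeasurableSet T)
    (h : ∀ n : ℕ, (Measure.pi fun _ : Fin n => ν) {x | ∑ i, Measure.dirac (x i) ∈ T} = 0) :
    poissonLaw ν T = 0 := by
  rw [poissonLaw, Measure.sum_apply _ hT, ENNReal.tsum_eq_zero]
  intro n
  rw [Measure.smul_apply, Measure.map_apply measurable_sum_dirac hT]
  exact (congrArg _ (h n)).trans (smul_zero _)

/-- Mecke's formula for the deletion of a uniform point in the window `W`. -/
lemma lintegral_delMass_poissonLaw (ν : Measure S) [IsFiniteMeasure ν] {W : Set S}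
    (hW : MeasurableSet W) {A : Set (SetFun S)} (hA : MeasurableSet A) :
    ∫⁻ ξ, delMass hW A ξ ∂poissonLaw ν =
      ν W * ∫⁻ ξ, (ξ W + 1)⁻¹ * (evalMap ⁻¹' A).indicator (fun _ => 1) ξ ∂poissonLaw ν := by
  set g : Measure S → ℝ≥0∞ := fun ξ => (ξ W + 1)⁻¹ * (evalMap ⁻¹' A).indicator (fun _ => 1) ξ
    with hg
  have hgm : Measurable g := ((Measure.measurable_coe hW).add_const 1).inv.mul
    (measurable_const.indicator (measurable_evalMap hA))
  rw [lintegral_poissonLaw ν (measurable_delMass hW hA), lintegral_poissonLaw ν hgm,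
    tsum_eq_zero_add' ENNReal.summable, ← ENNReal.tsum_mul_left]
  -- An empty configuration offers nothing to delete. With this term gone, `n + 1` points before
  -- deletion are matched with `n` points after it.
  have h0 : ∫⁻ x, delMass hW A (∑ i, Measure.dirac (x i)) ∂(Measure.pi fun _ : Fin 0 => ν) = 0 := by
    simp [delMass, condKernel]
  rw [h0, mul_zero, zero_add]
  refine tsum_congr fun n => ?_
  have key : ∀ i : Fin (n + 1), ∫⁻ x, W.indicator (fun _ => 1) (x i) *
      g (∑ j, Measure.dirac (x (i.succAbove j))) ∂(Measure.pi fun _ : Fin (n + 1) => ν) =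
      ν W * ∫⁻ x, g (∑ i, Measure.dirac (x i)) ∂Measure.pi fun _ : Fin n => ν := by
    intro i
    have hmp := measurePreserving_piFinSuccAbove (fun _ : Fin (n + 1) => ν) i
    have hF1 : Measurable fun a : S => W.indicator (fun _ => (1 : ℝ≥0∞)) a :=
      measurable_const.indicator hW
    have hF2 : Measurable fun y : Fin n → S => g (∑ j, Measure.dirac (y j)) :=
      hgm.comp measurable_sum_dirac
    have := lintegral_prod_mul (μ := ν) (ν := Measure.pi fun _ : Fin n => ν)
      hF1.aemeasurable hF2.aemeasurable
    rw [← hmp.lintegral_comp (f := fun p : S × (Fin n → S) => W.indicator (fun _ => (1 : ℝ≥0∞)) p.1 *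
      g (∑ j, Measure.dirac (p.2 j))) ((hF1.comp measurable_fst).mul (hF2.comp measurable_snd))]
      at this
    refine Eq.trans ?_ (this.trans ?_)
    · rfl
    · rw [lintegral_indicator_const hW, one_mul]
  -- If the deleted point lies in `W`, the configuration had one more point in `W` than what
  -- remains, which turns `(ξ W)⁻¹` into `(· + 1)⁻¹`.
  have hpt : ∀ x : Fin (n + 1) → S, delMass hW A (∑ i, Measure.dirac (x i)) =
      ∑ i, W.indicator (fun _ => 1) (x i) * g (∑ j, Measure.dirac (x (i.succAbove j))) := by
    intro x
    have hdec : ∀ i, ∑ i, Measure.dirac (x i) =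
        (∑ j, Measure.dirac (x (i.succAbove j))) + Measure.dirac (x i) := fun i => by
      rw [Fin.sum_univ_succAbove _ i, add_comm]
    rw [delMass_eq_tsum hW hA x (fun i => ∑ j, Measure.dirac (x (i.succAbove j)))
      (Measure.sum_fintype _).symm hdec, tsum_fintype]
    refine Finset.sum_congr rfl fun i _ => ?_
    by_cases hx : x i ∈ W
    · have : (∑ i, Measure.dirac (x i)) W = (∑ j, Measure.dirac (x (i.succAbove j))) W + 1 := by
        rw [hdec i, Measure.add_apply, Measure.dirac_apply' _ hW, indicator_of_mem hx, Pi.one_apply]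
      rw [this, indicator_of_mem hx, one_mul, one_mul]
    · simp [indicator_of_notMem hx]
  simp_rw [hpt]
  rw [lintegral_finsetSum]
  · simp_rw [key]
    -- The `n + 1` equal contributions turn the weight `1 / (n + 1)!` into `1 / n!`.
    rw [Finset.sum_const, Finset.card_univ, Fintype.card_fin, nsmul_eq_mul, ← mul_assoc,
      poissonWeight_succ]
    ring
  · intro i _
    refine Measurable.mul ((measurable_const.indicator hW).comp (measurable_pi_apply i)) ?_
    exact hgm.comp (measurable_sum_dirac.comp (measurable_pi_lambda _ fun j =>
      measurable_pi_apply (i.succAbove j)))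

end Poisson

/-! ### Gibbs processes: emptying a window around a single point -/

section Gibbs

variable {d : ℕ} {M Ω : Type*} [MeasurableSpace M] [MeasurableSpace Ω]

lemma measurable_restr {Λ : Set (Loc d)} (hΛ : MeasurableSet Λ) :
    Measurable (restr (M := M) Λ) := by
  refine Measure.measurable_of_measurable_coe _ fun B hB => ?_
  simp only [restr, Measure.restrict_apply hB]
  exact Measure.measurable_coe (hB.inter (hΛ.prod MeasurableSet.univ))

lemma measurable_energyDiff : Measurable fun p : EReal × EReal => energyDiff p.1 p.2 := by
  refine Measurable.ite (measurableSet_eq_fun measurable_fst measurable_snd) measurable_const ?_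
  simp only [sub_eq_add_neg]
  exact measurable_fst.add (continuous_neg.measurable.comp measurable_snd)

lemma Hamiltonian.measurable_localEnergy (H : Hamiltonian d M) {Λ : Set (Loc d)}
    (hΛ : MeasurableSet Λ) : Measurable (H.localEnergy Λ) := by
  refine Measurable.limsup fun n => ?_
  exact measurable_energyDiff.comp
    ((H.measurable_energy.comp (measurable_restr measurableSet_ball)).prodMk
      (H.measurable_energy.comp (measurable_restr (measurableSet_ball.diff hΛ))))

/-- The local energy in `Λ` of a configuration without points in `Λ` vanishes. -/
lemma Hamiltonian.localEnergy_restr_compl (H : Hamiltonian d M) {Λ : Set (Loc d)}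
    (hΛ : MeasurableSet Λ) (ξ : Measure (Loc d × M)) : H.localEnergy Λ (restr Λᶜ ξ) = 0 := by
  have h : ∀ n : ℕ, restr (Metric.ball 0 n) (restr Λᶜ ξ) =
      restr (Metric.ball 0 n \ Λ) (restr Λᶜ ξ) := by
    intro n
    have h1 : MeasurableSet (Metric.ball (0 : Loc d) n ×ˢ (univ : Set M)) :=
      measurableSet_ball.prod MeasurableSet.univ
    have h2 : MeasurableSet ((Metric.ball (0 : Loc d) n \ Λ) ×ˢ (univ : Set M)) :=
      (measurableSet_ball.diff hΛ).prod MeasurableSet.univ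
    simp only [restr, Measure.restrict_restrict h1, Measure.restrict_restrict h2]
    congr 1
    ext p
    simp only [mem_inter_iff, mem_prod, Set.mem_sdiff, mem_compl_iff, mem_univ]
    tauto
  -- Both energies coincide for every `n`; the convention `∞ - ∞ = 0` covers the case where they are
  -- infinite.
  simp [Hamiltonian.localEnergy, energyDiff, h]

lemma isFiniteMeasure_refIntensity (lam : ℝ≥0) (Q : Measure M) [IsProbabilityMeasure Q]
    {Λ : Set (Loc d)} (hb : Bornology.IsBounded Λ) :
    IsFiniteMeasure ((lam • (volume : Measure (Loc d)).restrict Λ).prod Q) := by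
  have : IsFiniteMeasure ((volume : Measure (Loc d)).restrict Λ) :=
    ⟨by simpa using hb.measure_lt_top⟩
  infer_instance

lemma measurable_add_restr {Λ : Set (Loc d)} (hΛ : MeasurableSet Λ) :
    Measurable fun p : Measure (Loc d × M) × Measure (Loc d × M) => p.1 + restr Λ p.2 := by
  refine Measure.measurable_of_measurable_coe _ fun B hB => ?_
  simp only [Measure.add_apply]
  exact ((Measure.measurable_coe hB).comp measurable_fst).add
    ((Measure.measurable_coe hB).comp ((measurable_restr hΛ).comp measurable_snd))

/-- Emptying a bounded window maps null events of a Gibbs process to null events. -/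
lemma IsGibbs.ae_restr_compl_notMem {P : Measure Ω} {X : Ω → Measure (Loc d × M)}
    {H : Hamiltonian d M} {lam : ℝ≥0} {Q : Measure M} [IsProbabilityMeasure Q]
    (hX : IsGibbs P X H lam Q) {Λ : Set (Loc d)} (hb : Bornology.IsBounded Λ)
    (hΛ : MeasurableSet Λ) (hZ : ∀ᵐ ω ∂P, partitionFunction H lam Q Λ (X ω) < ∞)
    {A : Set (Measure (Loc d × M))} (hA : MeasurableSet A) (hPA : P {ω | X ω ∈ A} = 0) :
    ∀ᵐ ω ∂P, restr Λᶜ (X ω) ∉ A := by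
  have := isFiniteMeasure_refIntensity lam Q hb
  have : IsProbabilityMeasure (refPoisson lam Q Λ) := isProbabilityMeasure_poissonLaw _
  have hlin : ∀ F : Measure (Loc d × M) → ℝ≥0∞, Measurable F →
      Measurable fun y => ∫⁻ x, F (x + restr Λᶜ y) ∂refPoisson lam Q Λ := fun F hF =>
    (hF.comp (measurable_add_restr hΛ.compl)).lintegral_prod_left'
  have hexp : Measurable fun ξ => EReal.exp (-H.localEnergy Λ ξ) :=
    EReal.measurable_exp.comp (continuous_neg.measurable.comp (H.measurable_localEnergy hΛ))
  have hg := ((hlin _ hexp).inv.mul (hlin _ (hexp.indicator hA))).comp hX.1.1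
  have h0 := hX.2 Λ hb hΛ A hA
  rw [hPA, eq_comm] at h0
  have h1 := (lintegral_eq_zero_iff hg).1 h0
  filter_upwards [h1, hZ] with ω hω hZω hmem
  have h2 := (mul_eq_zero.1 hω).resolve_left (ENNReal.inv_ne_zero.2 hZω.ne)
  have h3 := (lintegral_eq_zero_iff ((hexp.indicator hA).comp
    ((measurable_add_restr hΛ.compl).comp measurable_prodMk_right))).1 h2
  -- The integrand vanishes almost everywhere, yet at the empty configuration, which has positive
  -- probability, it would equal `exp 0 = 1`.
  have h4 : refPoisson lam Q Λ {ξ | ξ univ = 0} ≠ 0 := poissonLaw_empty_pos _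
  refine h4 (measure_mono_null ?_ (ae_iff.1 h3))
  intro x hx
  have hx0 : x = 0 := Measure.measure_univ_eq_zero.1 hx
  subst hx0
  simp [H.localEnergy_restr_compl hΛ, hmem]

/-- The DLR law is absolutely continuous inside `Λ`. By `hloc`, membership in `T` forces the part
sampled in `Λ` to lie in `T` already, so the boundary condition plays no role. -/
lemma IsGibbs.null_of_refPoisson {P : Measure Ω} {X : Ω → Measure (Loc d × M)}
    {H : Hamiltonian d M} {lam : ℝ≥0} {Q : Measure M}
    (hX : IsGibbs P X H lam Q) {Λ : Set (Loc d)} (hb : Bornology.IsBounded Λ)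
    (hΛ : MeasurableSet Λ) {T : Set (Measure (Loc d × M))} (hT : MeasurableSet T)
    (h0 : refPoisson lam Q Λ T = 0) (hloc : ∀ x y, x + restr Λᶜ y ∈ T → x ∈ T) :
    P {ω | X ω ∈ T} = 0 := by
  rw [hX.2 Λ hb hΛ T hT]
  have : ∀ ω, ∫⁻ x, T.indicator (fun ξ => EReal.exp (-H.localEnergy Λ ξ)) (x + restr Λᶜ (X ω))
      ∂refPoisson lam Q Λ = 0 := by
    intro ω
    rw [← lintegral_zero (μ := refPoisson lam Q Λ)]
    refine lintegral_congr_ae ?_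
    filter_upwards [measure_eq_zero_iff_ae_notMem.1 h0] with x hx
    exact indicator_of_notMem (fun h => hx (hloc _ _ h)) _
  simp [this]

/-- Configurations having, on all scales, two points close to each other in the ball of radius
`n` around the origin. -/
def clustered (d : ℕ) (M : Type*) [MeasurableSpace M] (n : ℕ) : Set (Measure (Loc d × M)) :=
  {ξ | ∀ m : ℕ, ∃ k : ℕ, 2 ≤ ξ ((Metric.ball (TopologicalSpace.denseSeq (Loc d) k)
    (1 / (m + 1)) ∩ Metric.ball 0 n) ×ˢ univ)}

lemma measurableSet_clustered (n : ℕ) : MeasurableSet (clustered d M n) := by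
  simp only [clustered, ofPred_forall, ofPred_exists]
  refine MeasurableSet.iInter fun m => MeasurableSet.iUnion fun k => ?_
  exact Measure.measurable_coe ((measurableSet_ball.inter measurableSet_ball).prod
    MeasurableSet.univ) measurableSet_Ici

lemma exists_pair_of_two_le {S : Type*} [MeasurableSpace S] {n : ℕ} {x : Fin n → S} {B : Set S}
    (hB : MeasurableSet B) (h : 2 ≤ (∑ i, Measure.dirac (x i)) B) :
    ∃ i j, i ≠ j ∧ x i ∈ B ∧ x j ∈ B := by
  classical
  have h1 : (∑ i, Measure.dirac (x i)) B = ((Finset.univ.filter fun i => x i ∈ B).card : ℝ≥0∞) := by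
    simp [Measure.finsetSum_apply, Measure.dirac_apply' _ hB, indicator_apply]
  rw [h1] at h
  have h2 : 1 < (Finset.univ.filter fun i => x i ∈ B).card := by exact_mod_cast h
  obtain ⟨i, hi, j, hj, hij⟩ := Finset.one_lt_card.1 h2
  exact ⟨i, j, hij, (Finset.mem_filter.1 hi).2, (Finset.mem_filter.1 hj).2⟩

/-- Finitely many distinct locations have a positive minimal distance `δ`, and a ball of radius
below `δ / 2` cannot contain two of them. -/
lemma exists_same_location {n N : ℕ} {x : Fin n → Loc d × M}
    (h : ∑ i, Measure.dirac (x i) ∈ clustered d M N) : ∃ i j, i ≠ j ∧ (x i).1 = (x j).1 := by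
  by_contra! hc
  have hpos : ∀ p : Fin n × Fin n, ∃ ε > 0, p.1 ≠ p.2 → ε ≤ dist (x p.1).1 (x p.2).1 := by
    intro p
    by_cases hp : p.1 = p.2
    · exact ⟨1, one_pos, fun h => absurd hp h⟩
    · exact ⟨_, dist_pos.2 (hc _ _ hp), fun _ => le_rfl⟩
  choose ε hε hεd using hpos
  obtain ⟨δ, hδ, hδε⟩ : ∃ δ > 0, ∀ p, δ ≤ ε p := by
    rcases isEmpty_or_nonempty (Fin n × Fin n) with he | he
    · exact ⟨1, one_pos, fun p => he.elim p⟩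
    · obtain ⟨p, hp⟩ := Finite.exists_min ε
      exact ⟨ε p, hε p, hp⟩
  obtain ⟨m, hm⟩ := exists_nat_one_div_lt (half_pos hδ)
  obtain ⟨k, hk⟩ := h m
  obtain ⟨i, j, hij, hi, hj⟩ := exists_pair_of_two_le
    ((measurableSet_ball.inter measurableSet_ball).prod MeasurableSet.univ) hk
  have h1 := hi.1.1
  have h2 := hj.1.1
  rw [Metric.mem_ball] at h1 h2
  have h3 := dist_triangle_right (x i).1 (x j).1 (TopologicalSpace.denseSeq (Loc d) k)
  have h4 := (hδε (i, j)).trans (hεd (i, j) hij)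
  dsimp only at h4
  linarith

/-- With the other points fixed, the location of point `i` is confined to a singleton, which is
Lebesgue null because `d > 0`. -/
lemma pi_same_location_null (hd : 0 < d) (lam : ℝ≥0) (Q : Measure M) [IsProbabilityMeasure Q]
    {Λ : Set (Loc d)} (hb : Bornology.IsBounded Λ) {n : ℕ} {i j : Fin n} (hij : i ≠ j) :
    (Measure.pi fun _ : Fin n => (lam • (volume : Measure (Loc d)).restrict Λ).prod Q)
      {x | (x i).1 = (x j).1} = 0 := by
  have := isFiniteMeasure_refIntensity lam Q hb
  have : NeZero d := ⟨hd.ne'⟩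
  set ν := (lam • (volume : Measure (Loc d)).restrict Λ).prod Q
  obtain ⟨n, rfl⟩ : ∃ n', n = n' + 1 := ⟨n - 1, by have := i.pos; omega⟩
  obtain ⟨k, rfl⟩ := Fin.exists_succAbove_eq hij.symm
  have hmp := measurePreserving_piFinSuccAbove (fun _ : Fin (n + 1) => ν) i
  have hms : MeasurableSet {p : (Loc d × M) × (Fin n → Loc d × M) | p.1.1 = (p.2 k).1} :=
    measurableSet_eq_fun (by fun_prop) (by fun_prop)
  have h0 := hmp.measure_preimage hms.nullMeasurableSet
  refine Eq.trans ?_ (h0.trans ?_)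
  · rfl
  · rw [Measure.prod_apply_symm hms, lintegral_eq_zero_iff (measurable_measure_prodMk_right hms)]
    refine Eventually.of_forall fun y => ?_
    have : (fun a : Loc d × M => (a, y)) ⁻¹' {p | p.1.1 = (p.2 k).1} = {(y k).1} ×ˢ univ := by
      ext a; simp
    dsimp only
    rw [this, Measure.prod_prod]
    simp

/-- Almost surely, a Gibbs process has no two points with the same location. -/
lemma IsGibbs.not_clustered (hd : 0 < d) {P : Measure Ω} {X : Ω → Measure (Loc d × M)}
    {H : Hamiltonian d M} {lam : ℝ≥0} {Q : Measure M} [IsProbabilityMeasure Q]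
    (hX : IsGibbs P X H lam Q) (N : ℕ) : ∀ᵐ ω ∂P, X ω ∉ clustered d M N := by
  refine measure_eq_zero_iff_ae_notMem.1 (hX.null_of_refPoisson Metric.isBounded_ball
    (measurableSet_ball (x := (0 : Loc d)) (ε := N)) (measurableSet_clustered N) ?_ ?_)
  · refine poissonLaw_null _ (measurableSet_clustered N) fun n => ?_
    refine measure_mono_null (t := ⋃ p : {p : Fin n × Fin n // p.1 ≠ p.2},
      {x | (x p.1.1).1 = (x p.1.2).1}) ?_ ?_
    · intro x hx
      obtain ⟨i, j, hij, h⟩ := exists_same_location hx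
      exact mem_iUnion.2 ⟨⟨(i, j), hij⟩, h⟩
    · exact measure_iUnion_null fun p => pi_same_location_null hd lam Q Metric.isBounded_ball p.2
  · intro x y h m
    obtain ⟨k, hk⟩ := h m
    refine ⟨k, ?_⟩
    rw [Measure.add_apply, restr, Measure.restrict_apply
      ((measurableSet_ball.inter measurableSet_ball).prod MeasurableSet.univ)] at hk
    convert hk using 1
    -- The windows that detect clustering lie inside the ball, so the part of `y` outside it is not
    -- counted.
    rw [show ((Metric.ball (TopologicalSpace.denseSeq (Loc d) k) (1 / ((m : ℝ) + 1)) ∩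
      Metric.ball 0 N) ×ˢ (univ : Set M)) ∩ (Metric.ball 0 N)ᶜ ×ˢ univ = ∅ from ?_]
    · simp
    · ext p
      simp only [mem_inter_iff, mem_prod, mem_compl_iff, mem_univ, mem_empty_iff_false]
      tauto

lemma IsConfig.eq_one_of_lt_two {ξ : Measure (Loc d × M)} (hξ : IsConfig ξ) {B : Set (Loc d × M)}
    (hB : MeasurableSet B) (h1 : 1 ≤ ξ B) (h2 : ξ B < 2) : ξ B = 1 := by
  obtain ⟨I, x, hx⟩ := hξ.1
  have h : ξ B = (({i | x i ∈ B} : Set I).encard : ℝ≥0∞) := by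
    rw [hx, Measure.sum_apply _ hB, ← ENNReal.tsum_set_one, tsum_subtype _ fun _ => (1 : ℝ≥0∞)]
    exact tsum_congr fun i => by by_cases h : x i ∈ B <;> simp [Measure.dirac_apply' _ hB, h]
  rw [h] at h1 h2 ⊢
  have h1' : (1 : ℕ∞) ≤ ({i | x i ∈ B} : Set I).encard := by exact_mod_cast h1
  have h2' : ({i | x i ∈ B} : Set I).encard < 2 := by exact_mod_cast h2
  have h3 : ({i | x i ∈ B} : Set I).encard = 1 :=
    le_antisymm (Order.le_of_lt_add_one (by rwa [one_add_one_eq_two])) h1'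
  simp [h3]

/-- Deleting the only point in a window amounts to emptying the window. -/
lemma sub_dirac_eq_restr_compl {ξ : Measure (Loc d × M)} {z : Loc d × M}
    (hz : Measure.dirac z ≤ ξ) {Λ : Set (Loc d)} (hΛ : MeasurableSet Λ) (hzΛ : z.1 ∈ Λ)
    (h1 : ξ (Λ ×ˢ univ) = 1) : ξ - Measure.dirac z = restr Λᶜ ξ := by
  have hW : MeasurableSet (Λ ×ˢ (univ : Set M)) := hΛ.prod MeasurableSet.univ
  -- The unit mass `δ_z` lies below a measure of total mass `1`, so the two are equal.
  have hr : ξ.restrict (Λ ×ˢ univ) = Measure.dirac z := by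
    have : IsFiniteMeasure (ξ.restrict (Λ ×ˢ univ)) := ⟨by simp [h1]⟩
    refine (Measure.eq_of_le_of_measure_univ_eq ?_ ?_).symm
    · classical
      calc Measure.dirac z = (Measure.dirac z).restrict (Λ ×ˢ univ) := by
            rw [restrict_dirac' hW, if_pos ⟨hzΛ, mem_univ _⟩]
        _ ≤ _ := Measure.restrict_mono subset_rfl hz
    · simp [h1]
  have hc : (Λ ×ˢ (univ : Set M))ᶜ = Λᶜ ×ˢ univ := by
    ext p; simp
  have h : ξ = restr Λᶜ ξ + Measure.dirac z := by
    rw [restr, ← hc, ← hr, add_comm, Measure.restrict_add_restrict_compl hW]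
  conv_lhs => rw [h]
  exact Measure.add_sub_cancel

theorem IsGibbs.deletionTolerant (hd : 0 < d) {P : Measure Ω} {X : Ω → Measure (Loc d × M)}
    {H : Hamiltonian d M} {lam : ℝ≥0} {Q : Measure M} [IsProbabilityMeasure Q]
    (hX : IsGibbs P X H lam Q)
    (hZ : ∀ Λ : Set (Loc d), Bornology.IsBounded Λ → MeasurableSet Λ →
      ∀ᵐ ω ∂P, partitionFunction H lam Q Λ (X ω) < ∞) : DeletionTolerant P X := by
  intro z hz A hA hPA
  -- Countably many windows suffice, so one exceptional null set serves them all and the window may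
  -- afterwards depend on `ω`.
  have h1 : ∀ᵐ ω ∂P, ∀ m k N : ℕ, restr (Metric.ball (TopologicalSpace.denseSeq (Loc d) k)
      (1 / ((m : ℝ) + 1)) ∩ Metric.ball 0 N)ᶜ (X ω) ∉ A := by
    simp only [ae_all_iff]
    intro m k N
    have hb : Bornology.IsBounded (Metric.ball (TopologicalSpace.denseSeq (Loc d) k)
      (1 / ((m : ℝ) + 1)) ∩ Metric.ball 0 N) := Metric.isBounded_ball.subset inter_subset_left
    have hm := (measurableSet_ball (x := TopologicalSpace.denseSeq (Loc d) k)
      (ε := 1 / ((m : ℝ) + 1))).inter (measurableSet_ball (x := (0 : Loc d)) (ε := N))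
    exact hX.ae_restr_compl_notMem hb hm (hZ _ hb hm) hA hPA
  suffices ∀ᵐ ω ∂P, ¬ (X ω - Measure.dirac (z ω) ∈ A) by
    simpa [ae_iff] using this
  filter_upwards [h1, ae_all_iff.2 (hX.not_clustered hd), hz.2, hX.1.2] with ω ha hs hzω hc
  obtain ⟨N, hN⟩ := exists_nat_gt ‖(z ω).1‖
  have hsN := hs N
  simp only [clustered, mem_ofPred_eq, not_forall, not_exists, not_le] at hsN
  obtain ⟨m, hm⟩ := hsN
  obtain ⟨k, hk⟩ := (TopologicalSpace.denseRange_denseSeq (Loc d)).exists_dist_lt (z ω).1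
    (ε := 1 / ((m : ℝ) + 1)) (by positivity)
  have hΛ := (measurableSet_ball (x := TopologicalSpace.denseSeq (Loc d) k)
      (ε := 1 / ((m : ℝ) + 1))).inter (measurableSet_ball (x := (0 : Loc d)) (ε := N))
  have hzΛ : (z ω).1 ∈ Metric.ball (TopologicalSpace.denseSeq (Loc d) k)
      (1 / ((m : ℝ) + 1)) ∩ Metric.ball 0 N := ⟨hk, by simpa using hN⟩
  have hW : MeasurableSet ((Metric.ball (TopologicalSpace.denseSeq (Loc d) k)
      (1 / ((m : ℝ) + 1)) ∩ Metric.ball 0 N) ×ˢ (univ : Set M)) := hΛ.prod MeasurableSet.univ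
  have hone : 1 ≤ X ω ((Metric.ball (TopologicalSpace.denseSeq (Loc d) k)
      (1 / ((m : ℝ) + 1)) ∩ Metric.ball 0 N) ×ˢ univ) := by
    refine le_trans ?_ (hzω _)
    rw [Measure.dirac_apply' _ hW, indicator_of_mem (mk_mem_prod hzΛ (mem_univ (z ω).2)), Pi.one_apply]
  rw [sub_dirac_eq_restr_compl hzω hΛ hzΛ (hc.eq_one_of_lt_two hW hone (hm k))]
  exact ha m k N

end Gibbs

/-! ### Enumerated configurations and deletion of an index -/

section Enumerated

variable {S : Type*} [MeasurableSpace S]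

/-- The configuration `∑_{i ∈ I} δ_{xᵢ}`. -/
def pts (c : Set ℕ × (ℕ → S)) : Measure S := Measure.sum fun i : c.1 => Measure.dirac (c.2 i)

/-- Deletion of the index `i`. -/
def delIdx (i : ℕ) (c : Set ℕ × (ℕ → S)) : Set ℕ × (ℕ → S) := (c.1 \ {i}, c.2)

lemma pts_apply (c : Set ℕ × (ℕ → S)) {B : Set S} (hB : MeasurableSet B) :
    pts c B = ∑' i : ℕ, c.1.indicator (fun i => B.indicator 1 (c.2 i)) i := by
  rw [pts, Measure.sum_apply _ hB, ← tsum_subtype]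
  exact tsum_congr fun i => Measure.dirac_apply' _ hB

lemma measurableSet_mem_fst (i : ℕ) : MeasurableSet {c : Set ℕ × (ℕ → S) | i ∈ c.1} :=
  ((measurable_set_mem i).comp measurable_fst).setOf

lemma measurable_indicator_mem {T : Type*} [MeasurableSpace T] {f : T → Set ℕ × (ℕ → S)}
    (hf : Measurable f) {g : T → ℝ≥0∞} (hg : Measurable g) (i : ℕ) :
    Measurable fun t => (f t).1.indicator (fun _ => g t) i := by
  classical
  simp only [indicator_apply]
  exact Measurable.ite (hf (measurableSet_mem_fst i)) hg measurable_const

lemma measurable_pts : Measurable (pts (S := S)) := by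
  refine Measure.measurable_of_measurable_coe _ fun B hB => ?_
  simp only [pts_apply _ hB]
  refine Measurable.tsum fun i => ?_
  exact measurable_indicator_mem measurable_id
    ((measurable_one.indicator hB).comp ((measurable_pi_apply i).comp measurable_snd)) i

lemma measurable_delIdx (i : ℕ) : Measurable (delIdx (S := S) i) := by
  refine Measurable.prodMk (measurable_set_iff.2 fun a => ?_) measurable_snd
  by_cases h : a = i
  · simp [h]
  · simp only [Set.mem_sdiff, mem_singleton_iff, h, not_false_eq_true, and_true]
    exact (measurable_set_mem a).comp measurable_fst

lemma pts_eq_delIdx_add {c : Set ℕ × (ℕ → S)} {i : ℕ} (hi : i ∈ c.1) :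
    pts c = pts (delIdx i c) + Measure.dirac (c.2 i) := by
  classical
  ext B hB
  rw [Measure.add_apply, pts_apply _ hB, pts_apply _ hB, Measure.dirac_apply' _ hB,
    ENNReal.tsum_eq_add_tsum_ite i, indicator_of_mem hi, add_comm]
  congr 1
  refine tsum_congr fun j => ?_
  by_cases hj : j = i <;> simp [delIdx, hj, indicator_apply]

/-- The probability that the point with index `i` is chosen as a uniform point in `W`. -/
def delWeight (W : Set S) (i : ℕ) (c : Set ℕ × (ℕ → S)) : ℝ≥0∞ :=
  c.1.indicator (fun i => (pts c W)⁻¹ * W.indicator (fun _ => 1) (c.2 i)) i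

lemma measurable_delWeight {W : Set S} (hW : MeasurableSet W) (i : ℕ) :
    Measurable (delWeight W i) := by
  have h : Measurable fun c : Set ℕ × (ℕ → S) =>
      c.1.indicator (fun _ => (pts c W)⁻¹ * W.indicator (fun _ => 1) (c.2 i)) i :=
    measurable_indicator_mem measurable_id
      (((Measure.measurable_coe hW).comp measurable_pts).inv.mul ((measurable_const.indicator hW).comp
        ((measurable_pi_apply i).comp measurable_snd))) i
  exact h

lemma delMass_pts {W : Set S} (hW : MeasurableSet W) {A : Set (SetFun S)} (hA : MeasurableSet A)
    (c : Set ℕ × (ℕ → S)) :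
    delMass hW A (pts c) = ∑' i : ℕ, delWeight W i c *
      (evalMap ⁻¹' A).indicator (fun _ => 1) (pts (delIdx i c)) := by
  rw [delMass_eq_tsum hW hA (ι := c.1) (ξ := pts c) (fun i => c.2 i) (fun i => pts (delIdx i c)) rfl
    (fun i => pts_eq_delIdx_add i.2), tsum_subtype c.1 fun i => (pts c W)⁻¹ *
      (W.indicator (fun _ => 1) (c.2 i) *
        (evalMap ⁻¹' A).indicator (fun _ => 1) (pts (delIdx i c)))]
  refine tsum_congr fun i => ?_
  by_cases hi : i ∈ c.1 <;> simp [delWeight, hi, mul_assoc]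

/-- The law of the configuration without a uniform point in `W`, restricted to the event that there
is one. -/
def delLaw (ρ : Measure (Set ℕ × (ℕ → S))) (W : Set S) : Measure (Measure S) :=
  Measure.sum fun i => (ρ.withDensity (delWeight W i)).map fun c => pts (delIdx i c)

lemma delLaw_apply (ρ : Measure (Set ℕ × (ℕ → S))) {W : Set S} (hW : MeasurableSet W)
    {A : Set (SetFun S)} (hA : MeasurableSet A) :
    delLaw ρ W (evalMap ⁻¹' A) = ∫⁻ c, delMass hW A (pts c) ∂ρ := by
  obtain ⟨E, hE⟩ : ∃ E : Set (Measure S), E = evalMap ⁻¹' A := ⟨_, rfl⟩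
  have hEm : MeasurableSet E := hE ▸ measurable_evalMap hA
  have hm : ∀ i, Measurable fun c : Set ℕ × (ℕ → S) => pts (delIdx i c) :=
    fun i => measurable_pts.comp (measurable_delIdx i)
  have hi : ∀ i, Measurable fun c : Set ℕ × (ℕ → S) =>
      E.indicator (fun _ => (1 : ℝ≥0∞)) (pts (delIdx i c)) :=
    fun i => (measurable_const.indicator hEm).comp (hm i)
  simp only [delMass_pts hW hA]
  rw [← hE, delLaw, Measure.sum_apply _ hEm]
  refine Eq.trans ?_ (lintegral_tsum fun i =>
    ((measurable_delWeight hW i).mul (hi i)).aemeasurable).symm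
  refine tsum_congr fun i => ?_
  have h1 := lintegral_withDensity_eq_lintegral_mul ρ (measurable_delWeight hW i) (hi i)
  refine Eq.trans ?_ h1
  rw [Measure.map_apply (hm i) hEm, ← lintegral_indicator_one (hm i hEm)]
  rfl

lemma isFiniteMeasure_delLaw (ρ : Measure (Set ℕ × (ℕ → S))) [IsProbabilityMeasure ρ] {W : Set S}
    (hW : MeasurableSet W) : IsFiniteMeasure (delLaw ρ W) := by
  constructor
  have h := delLaw_apply ρ hW (A := univ) MeasurableSet.univ
  rw [preimage_univ] at h
  rw [h]
  refine lt_of_le_of_lt (lintegral_mono fun c => delMass_le_one hW univ (pts c)) ?_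
  simp

/-- Every index with its point in `W` has the positive weight `1 / ξ W`, so a null event for uniform
deletion is avoided by all these deletions simultaneously. -/
lemma ae_delIdx_notMem {ρ : Measure (Set ℕ × (ℕ → S))} {W : Set S} (hW : MeasurableSet W)
    (hρ : ∀ᵐ c ∂ρ, pts c W ≠ ∞) {A : Set (Measure S)} (hA : MeasurableSet A)
    (h0 : delLaw ρ W A = 0) :
    ∀ᵐ c ∂ρ, ∀ i ∈ c.1, c.2 i ∈ W → pts (delIdx i c) ∉ A := by
  obtain ⟨A', hA', rfl⟩ := exists_evalMap_preimage hA
  rw [delLaw_apply ρ hW hA'] at h0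
  replace h0 := (lintegral_eq_zero_iff ((measurable_delMass hW hA').comp measurable_pts)).1 h0
  filter_upwards [h0, hρ] with c hc hfin i hi hiW hmem
  rw [Function.comp_apply, delMass_pts hW hA', Pi.zero_apply, ENNReal.tsum_eq_zero] at hc
  have := hc i
  rw [delWeight, indicator_of_mem hi, indicator_of_mem hiW, indicator_of_mem hmem, mul_one,
    mul_one] at this
  exact ENNReal.inv_ne_zero.2 hfin this

end Enumerated

/-! ### Integration against a mixture of measures -/

section Mixture

/-- No measurability of `K` is assumed: on simple functions only the superadditivity of the lower
integral is used, which gives the inequality in the direction needed. It will be applied to `γ ↦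
poissonLaw (γ.restrict V)`. -/
lemma lintegral_le_lintegral_lintegral {α β : Type*} [MeasurableSpace α] [MeasurableSpace β]
    {μ : Measure β} {θ : Measure α} {K : α → Measure β}
    (h : ∀ A, MeasurableSet A → μ A ≤ ∫⁻ a, K a A ∂θ) (F : β → ℝ≥0∞) :
    ∫⁻ b, F b ∂μ ≤ ∫⁻ a, ∫⁻ b, F b ∂K a ∂θ := by
  classical
  rw [lintegral]
  refine iSup₂_le fun s hs => ?_
  have hsum : ∀ (T : Finset ℝ≥0∞), ∑ r ∈ T, r * μ (s ⁻¹' {r}) ≤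
      ∫⁻ a, ∑ r ∈ T, r * K a (s ⁻¹' {r}) ∂θ := by
    intro T
    induction T using Finset.induction_on with
    | empty => simp
    | insert r T hr ih =>
      simp only [Finset.sum_insert hr]
      refine le_trans (add_le_add ?_ ih) (le_lintegral_add _ _)
      exact (mul_le_mul_right (h _ (s.measurableSet_fiber r)) r).trans (lintegral_const_mul_le _ _)
  refine (hsum _).trans (lintegral_mono fun a => ?_)
  have : s.lintegral (K a) ≤ ∫⁻ b, F b ∂K a := by
    rw [← SimpleFunc.lintegral_eq_lintegral]
    exact lintegral_mono hs
  exact this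

end Mixture

/-! ### Local events of location configurations -/

section Cylinder

variable {d : ℕ}

/-- Events which depend on the configuration in a bounded window only. -/
def cylinders (d : ℕ) : Set (Set (Measure (Loc d))) :=
  {A | ∃ (N : ℕ) (B : Set (Measure (Loc d))), MeasurableSet B ∧
    A = {ξ | ξ.restrict (Metric.ball 0 N) ∈ B}}

lemma measurable_restrict_set {S : Type*} [MeasurableSpace S] {V : Set S} (hV : MeasurableSet V) :
    Measurable fun ξ : Measure S => ξ.restrict V := by
  refine Measure.measurable_of_measurable_coe _ fun B hB => ?_
  simp only [Measure.restrict_apply hB]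
  exact Measure.measurable_coe (hB.inter hV)

lemma exists_cylinder_of_le {A : Set (Measure (Loc d))} {N : ℕ} {B : Set (Measure (Loc d))}
    (hB : MeasurableSet B) (hA : A = {ξ | ξ.restrict (Metric.ball 0 N) ∈ B}) {N' : ℕ}
    (h : N ≤ N') : ∃ B' : Set (Measure (Loc d)), MeasurableSet B' ∧
      A = {ξ | ξ.restrict (Metric.ball 0 N') ∈ B'} := by
  refine ⟨_, measurable_restrict_set (measurableSet_ball (x := (0 : Loc d)) (ε := N)) hB, ?_⟩
  rw [hA]
  ext ξ
  have hs : Metric.ball (0 : Loc d) N ⊆ Metric.ball 0 N' :=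
    Metric.ball_subset_ball (by exact_mod_cast h)
  simp [Measure.restrict_restrict_of_subset hs]

lemma isSetRing_cylinders : IsSetRing (cylinders d) where
  empty_mem := ⟨0, ∅, MeasurableSet.empty, by simp⟩
  union_mem := by
    rintro A₁ A₂ ⟨N₁, B₁, hB₁, h₁⟩ ⟨N₂, B₂, hB₂, h₂⟩
    obtain ⟨C₁, hC₁, e₁⟩ := exists_cylinder_of_le hB₁ h₁ (le_max_left N₁ N₂)
    obtain ⟨C₂, hC₂, e₂⟩ := exists_cylinder_of_le hB₂ h₂ (le_max_right N₁ N₂)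
    exact ⟨max N₁ N₂, C₁ ∪ C₂, hC₁.union hC₂, by rw [e₁, e₂]; rfl⟩
  sdiff_mem := by
    rintro A₁ A₂ ⟨N₁, B₁, hB₁, h₁⟩ ⟨N₂, B₂, hB₂, h₂⟩
    obtain ⟨C₁, hC₁, e₁⟩ := exists_cylinder_of_le hB₁ h₁ (le_max_left N₁ N₂)
    obtain ⟨C₂, hC₂, e₂⟩ := exists_cylinder_of_le hB₂ h₂ (le_max_right N₁ N₂)
    exact ⟨max N₁ N₂, C₁ \ C₂, hC₁.diff hC₂, by rw [e₁, e₂]; rfl⟩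

lemma iUnion_inter_ball (B : Set (Loc d)) : ⋃ N : ℕ, B ∩ Metric.ball 0 N = B := by
  rw [← inter_iUnion, Metric.iUnion_ball_nat, inter_univ]

lemma generateFrom_cylinders :
    (Measure.instMeasurableSpace : MeasurableSpace (Measure (Loc d))) =
      MeasurableSpace.generateFrom (cylinders d) := by
  refine le_antisymm (iSup₂_le fun B hB => ?_) (MeasurableSpace.generateFrom_le ?_)
  · rw [← measurable_iff_comap_le]
    -- The mass of an unbounded set is the supremum of its masses within balls, each of which is a
    -- local quantity.
    have : (fun ξ : Measure (Loc d) => ξ B) =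
        fun ξ => ⨆ N : ℕ, (ξ.restrict (Metric.ball 0 N)) B := by
      funext ξ
      simp only [Measure.restrict_apply hB]
      rw [← Monotone.measure_iUnion, iUnion_inter_ball]
      exact fun m n h => inter_subset_inter_right _ (Metric.ball_subset_ball (by exact_mod_cast h))
    rw [this]
    refine @Measurable.iSup _ _ _ _ _ (MeasurableSpace.generateFrom (cylinders d)) _ _ _ _ _ _
      fun N => ?_
    intro T hT
    exact MeasurableSpace.measurableSet_generateFrom
      ⟨N, {ξ | ξ B ∈ T}, Measure.measurable_coe hB hT, rfl⟩
  · rintro A ⟨N, B, hB, rfl⟩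
    exact measurable_restrict_set measurableSet_ball hB

/-- The restriction to `V`, in terms of set functions. -/
def restrictEval {S : Type*} [MeasurableSpace S] {V : Set S} (hV : MeasurableSet V)
    (e : SetFun S) : SetFun S := fun B => e ⟨(B : Set S) ∩ V, B.2.inter hV⟩

lemma measurable_restrictEval {S : Type*} [MeasurableSpace S] {V : Set S} (hV : MeasurableSet V) :
    Measurable (restrictEval hV) :=
  measurable_pi_lambda _ fun _ => measurable_pi_apply _

lemma evalMap_restrict {S : Type*} [MeasurableSpace S] {V : Set S} (hV : MeasurableSet V)
    (ξ : Measure S) : evalMap (ξ.restrict V) = restrictEval hV (evalMap ξ) :=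
  funext fun B => Measure.restrict_apply B.2

/-- Deletion in `W` commutes with the restriction to a larger window `V`. -/
lemma delMass_restrict {S : Type*} [MeasurableSpace S] {W V : Set S} (hW : MeasurableSet W)
    (hV : MeasurableSet V) (hWV : W ⊆ V) (A : Set (SetFun S)) (ξ : Measure S) :
    delMass hW A (ξ.restrict V) =
      delMass hW (restrictEval hV ⁻¹' A) ξ := by
  simp only [delMass, condKernel, Kernel.coe_mk, lintegral_smul_measure,
    Measure.restrict_restrict_of_subset hWV, Measure.restrict_eq_self _ hWV]
  congr 1
  refine setLIntegral_congr_fun hW fun z hz => ?_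
  have : delEval (ξ.restrict V, z) = restrictEval hV (delEval (ξ, z)) := by
    funext B
    simp only [delEval, restrictEval, Measure.restrict_apply B.2]
    rw [Measure.dirac_apply' _ B.2, Measure.dirac_apply' _ (B.2.inter hV)]
    by_cases hzB : z ∈ (B : Set S) <;> simp [hzB, hWV hz]
  change A.indicator _ (delEval (ξ.restrict V, z)) = _
  rw [this]
  rfl

end Cylinder

/-! ### Deletion of a location from a Cox process -/

section CoxLocations

variable {d : ℕ}

/-- Where `γ W ≤ c`, Mecke's formula with `(ξ W + 1)⁻¹ ≤ 1` gives the factor `c`; elsewhere the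
deletion probability is bounded by `1`. Local events are required since the Cox property prescribes
laws in bounded windows only. -/
lemma delLaw_cylinder_le {ρ : Measure (Set ℕ × (ℕ → Loc d))}
    {θ : Measure (Measure (Loc d))} (hθ : ∀ᵐ γ ∂θ, IsLocallyFiniteMeasure γ)
    (hcox : ∀ Λ : Set (Loc d), Bornology.IsBounded Λ → MeasurableSet Λ →
      ∀ A : Set (Measure (Loc d)), MeasurableSet A →
        ρ.map pts {ξ | ξ.restrict Λ ∈ A} = ∫⁻ γ, poissonLaw (γ.restrict Λ) A ∂θ)
    (n c : ℕ) {A : Set (Measure (Loc d))} (hA : A ∈ cylinders d) :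
    delLaw ρ (Metric.ball 0 n) A ≤
      c * ρ.map pts A + θ {γ | (c : ℝ≥0∞) < γ (Metric.ball 0 n)} := by
  obtain ⟨N₀, B₀, hB₀, h₀⟩ := hA
  obtain ⟨B, hB, hAB⟩ := exists_cylinder_of_le hB₀ h₀ (le_max_left N₀ n)
  obtain ⟨N, hN⟩ : ∃ N, N = max N₀ n := ⟨_, rfl⟩
  rw [← hN] at hAB
  have hnN : Metric.ball (0 : Loc d) n ⊆ Metric.ball 0 N :=
    Metric.ball_subset_ball (by rw [hN]; exact_mod_cast le_max_right N₀ n)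
  set V := Metric.ball (0 : Loc d) N with hVdef
  set W := Metric.ball (0 : Loc d) n with hWdef
  have hV : MeasurableSet V := measurableSet_ball
  have hW : MeasurableSet W := measurableSet_ball
  obtain ⟨B', hB', rfl⟩ := exists_evalMap_preimage hB
  have hAe : A = evalMap ⁻¹' (restrictEval hV ⁻¹' B') := by
    rw [hAB]
    ext ξ
    simp only [mem_ofPred_eq, mem_preimage, evalMap_restrict hV]
  have hpV := measurable_restrict_set hV
  have hdm := measurable_delMass hW hB'
  have hmain : ∀ᵐ γ ∂θ, ∫⁻ ξ, delMass hW B' ξ ∂poissonLaw (γ.restrict V) ≤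
      c * poissonLaw (γ.restrict V) (evalMap ⁻¹' B') +
        {γ : Measure (Loc d) | (c : ℝ≥0∞) < γ W}.indicator 1 γ := by
    filter_upwards [hθ] with γ hγ
    have : IsFiniteMeasure (γ.restrict V) :=
      ⟨by simpa [hVdef] using Metric.isBounded_ball.measure_lt_top⟩
    by_cases hc : (c : ℝ≥0∞) < γ W
    · rw [indicator_of_mem (show γ ∈ _ from hc)]
      refine le_trans ?_ le_add_self
      refine (lintegral_mono fun ξ => delMass_le_one hW B' ξ).trans ?_
      simp
    · refine le_trans ?_ le_self_add
      rw [lintegral_delMass_poissonLaw _ hW hB', Measure.restrict_eq_self _ hnN,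
        ← lintegral_indicator_one hB]
      refine mul_le_mul' (not_lt.1 hc) (lintegral_mono fun ξ => ?_)
      refine (mul_le_mul_left (ENNReal.inv_le_one.2 le_add_self) _).trans ?_
      rw [one_mul]
      rfl
  have hbig : MeasurableSet {γ : Measure (Loc d) | (c : ℝ≥0∞) < γ W} :=
    measurableSet_lt measurable_const (Measure.measurable_coe hW)
  calc delLaw ρ W A = ∫⁻ x, delMass hW B' ((pts x).restrict V) ∂ρ := by
        rw [hAe, delLaw_apply ρ hW (measurable_restrictEval hV hB')]
        simp only [delMass_restrict hW hV hnN]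
    _ = ∫⁻ ξ, delMass hW B' ξ ∂(ρ.map pts).map fun ξ => ξ.restrict V := by
        rw [lintegral_map hdm hpV]
        exact (lintegral_map (hdm.comp hpV) measurable_pts).symm
    _ ≤ ∫⁻ γ, ∫⁻ ξ, delMass hW B' ξ ∂poissonLaw (γ.restrict V) ∂θ := by
        refine lintegral_le_lintegral_lintegral (fun E hE => ?_) _
        rw [Measure.map_apply hpV hE]
        exact (hcox V Metric.isBounded_ball hV E hE).le
    _ ≤ ∫⁻ γ, (c * poissonLaw (γ.restrict V) (evalMap ⁻¹' B') +
        {γ : Measure (Loc d) | (c : ℝ≥0∞) < γ W}.indicator 1 γ) ∂θ := lintegral_mono_ae hmain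
    _ = c * ρ.map pts A + θ {γ | (c : ℝ≥0∞) < γ W} := by
        rw [lintegral_add_right _ (measurable_one.indicator hbig), lintegral_indicator_one hbig,
          lintegral_const_mul' _ _ (ENNReal.natCast_ne_top c), hAB,
          hcox V Metric.isBounded_ball hV _ hB]

lemma tendsto_measure_lt_ball {θ : Measure (Measure (Loc d))} [IsFiniteMeasure θ]
    (hθ : ∀ᵐ γ ∂θ, IsLocallyFiniteMeasure γ) (n : ℕ) :
    Tendsto (fun c : ℕ => θ {γ | (c : ℝ≥0∞) < γ (Metric.ball 0 n)}) atTop (nhds 0) := by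
  have hm : ∀ c : ℕ, MeasurableSet {γ : Measure (Loc d) | (c : ℝ≥0∞) < γ (Metric.ball 0 n)} :=
    fun c => measurableSet_lt measurable_const (Measure.measurable_coe measurableSet_ball)
  have h := tendsto_measure_iInter_atTop (μ := θ) (fun c => (hm c).nullMeasurableSet)
    (fun a b hab γ (hγ : (b : ℝ≥0∞) < _) =>
      (lt_of_le_of_lt (by exact_mod_cast hab) hγ : (a : ℝ≥0∞) < _)) ⟨0, measure_ne_top _ _⟩
  suffices θ (⋂ c : ℕ, {γ | (c : ℝ≥0∞) < γ (Metric.ball 0 n)}) = 0 by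
    rwa [this] at h
  rw [measure_eq_zero_iff_ae_notMem]
  filter_upwards [hθ] with γ hγ hmem
  have hlt : γ (Metric.ball 0 n) < ∞ := Metric.isBounded_ball.measure_lt_top
  obtain ⟨c, hc⟩ := ENNReal.exists_nat_gt hlt.ne
  exact lt_asymm hc (mem_iInter.1 hmem c)

/-- The locations of a Cox process are deletion-tolerant. -/
lemma delLaw_eq_zero_of_cox {ρ : Measure (Set ℕ × (ℕ → Loc d))} [IsProbabilityMeasure ρ]
    {θ : Measure (Measure (Loc d))} [IsFiniteMeasure θ] (hθ : ∀ᵐ γ ∂θ, IsLocallyFiniteMeasure γ)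
    (hcox : ∀ Λ : Set (Loc d), Bornology.IsBounded Λ → MeasurableSet Λ →
      ∀ A : Set (Measure (Loc d)), MeasurableSet A →
        ρ.map pts {ξ | ξ.restrict Λ ∈ A} = ∫⁻ γ, poissonLaw (γ.restrict Λ) A ∂θ)
    (n : ℕ) {A : Set (Measure (Loc d))} (hA : MeasurableSet A) (h0 : ρ.map pts A = 0) :
    delLaw ρ (Metric.ball 0 n) A = 0 := by
  have hfin := isFiniteMeasure_delLaw ρ (measurableSet_ball (x := (0 : Loc d)) (ε := n))
  rw [← nonpos_iff_eq_zero]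
  refine ENNReal.le_of_forall_pos_le_add fun ε hε _ => ?_
  rw [zero_add]
  have hε2 : (0 : ℝ≥0∞) < ε / 2 := ENNReal.half_pos (by exact_mod_cast hε.ne')
  obtain ⟨c, hc⟩ := ((tendsto_measure_lt_ball hθ n).eventually (gt_mem_nhds hε2)).exists
  have hc0 : ((c + 1 : ℕ) : ℝ≥0∞) ≠ 0 := by simp
  -- Approximating for the sum of both laws controls both errors: with `a` and `b` the masses of the
  -- symmetric difference, the total error is `c * b + a ≤ (c + 1) * (a + b)`, whence the tolerance
  -- `ε / 2 / (c + 1)`.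
  obtain ⟨T, hT, hTA⟩ := exists_measure_symmDiff_lt_of_generateFrom_isSetRing
    (μ := delLaw ρ (Metric.ball 0 n) + ρ.map pts) isSetRing_cylinders
    ⟨{univ}, countable_singleton _, by
      simpa using ⟨0, univ, MeasurableSet.univ, by simp⟩, by simp⟩
    generateFrom_cylinders hA
    (ε := (ε : ℝ≥0∞) / 2 / (c + 1 : ℕ)) (ENNReal.div_pos hε2.ne' (ENNReal.natCast_ne_top _))
  rw [Measure.add_apply] at hTA
  have h1 : delLaw ρ (Metric.ball 0 n) A ≤
      delLaw ρ (Metric.ball 0 n) T + delLaw ρ (Metric.ball 0 n) (symmDiff T A) := by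
    refine (measure_mono fun ξ hξ => ?_).trans (measure_union_le _ _)
    by_cases h : ξ ∈ T
    · exact Or.inl h
    · exact Or.inr (Or.inr ⟨hξ, h⟩)
  have h2 : ρ.map pts T ≤ ρ.map pts (symmDiff T A) := by
    refine ((measure_mono fun ξ hξ => ?_).trans (measure_union_le A (symmDiff T A))).trans
      (by rw [h0, zero_add])
    by_cases h : ξ ∈ A
    · exact Or.inl h
    · exact Or.inr (Or.inl ⟨hξ, h⟩)
  have h3 := delLaw_cylinder_le hθ hcox n c hT
  set a := delLaw ρ (Metric.ball 0 n) (symmDiff T A)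
  set b := ρ.map pts (symmDiff T A)
  calc delLaw ρ (Metric.ball 0 n) A ≤ (c * b + ε / 2) + a :=
        h1.trans (add_le_add (h3.trans (add_le_add (mul_le_mul_right h2 _) hc.le)) le_rfl)
    _ = (c * b + a) + ε / 2 := by ring
    _ ≤ ((c + 1 : ℕ) * (a + b)) + ε / 2 := by
        refine add_le_add ?_ le_rfl
        push_cast
        calc (c : ℝ≥0∞) * b + a ≤ (c * b + a) + (c * a + b) := le_self_add
          _ = _ := by ring
    _ ≤ (c + 1 : ℕ) * ((ε : ℝ≥0∞) / 2 / (c + 1 : ℕ)) + ε / 2 :=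
        add_le_add (mul_le_mul_right hTA.le _) le_rfl
    _ = ε := by rw [ENNReal.mul_div_cancel hc0 (ENNReal.natCast_ne_top _), ENNReal.add_halves]

end CoxLocations

/-! ### Independence of the marked law from the enumeration -/

section Exchangeability

/-- Two enumerations of the same configuration differ by a bijection of the index sets. -/
lemma exists_equiv_of_pts_eq {S : Type*} [MeasurableSpace S] [MeasurableSingletonClass S]
    {c c' : Set ℕ × (ℕ → S)} (h : pts c = pts c') :
    ∃ e : c.1 ≃ c'.1, ∀ i : c.1, c'.2 (e i) = c.2 i := by
  have hcard : ∀ (c : Set ℕ × (ℕ → S)) (v : S),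
      pts c {v} = (ENat.card {i : c.1 // c.2 i = v} : ℝ≥0∞) := by
    intro c v
    rw [pts, Measure.sum_apply _ (measurableSet_singleton v), ← ENNReal.tsum_one]
    refine Eq.trans ?_ (tsum_subtype {i : c.1 | c.2 i = v} fun _ => (1 : ℝ≥0∞)).symm
    refine tsum_congr fun i => ?_
    by_cases hi : c.2 i = v <;> simp [hi]
  have hne : ∀ v : S, Nonempty ({i : c.1 // c.2 i = v} ≃ {j : c'.1 // c'.2 j = v}) := by
    intro v
    rw [← Cardinal.eq]
    -- The fibres over `v` are countable, so equal multiplicities in `ℕ∞` already give equal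
    -- cardinals and hence a bijection.
    refine Cardinal.toENat_injOn (mem_Iic.2 Cardinal.mk_le_aleph0)
      (mem_Iic.2 Cardinal.mk_le_aleph0) ?_
    have := hcard c v
    rw [h, hcard c' v] at this
    exact (ENat.toENNReal_inj.1 this).symm
  let e : c.1 ≃ c'.1 := (Equiv.sigmaFiberEquiv fun i : c.1 => c.2 i).symm.trans
    ((Equiv.sigmaCongrRight fun v => (hne v).some).trans
      (Equiv.sigmaFiberEquiv fun j : c'.1 => c'.2 j))
  exact ⟨e, fun i => ((hne (c.2 i)).some ⟨i, rfl⟩).2⟩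

variable {S M : Type*} [MeasurableSpace S] [MeasurableSpace M]

/-- The points `xᵢ` equipped with the marks `qᵢ`. -/
def zipMarks (c : (Set ℕ × (ℕ → S)) × (ℕ → M)) : Set ℕ × (ℕ → S × M) :=
  (c.1.1, fun i => (c.1.2 i, c.2 i))

lemma measurable_zipMarks : Measurable (zipMarks (S := S) (M := M)) := by
  unfold zipMarks
  fun_prop

lemma map_fst_pts_zipMarks (c : (Set ℕ × (ℕ → S)) × (ℕ → M)) :
    (pts (zipMarks c)).map Prod.fst = pts c.1 := by
  ext B hB
  rw [Measure.map_apply measurable_fst hB, pts_apply _ (measurable_fst hB), pts_apply _ hB]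
  rfl

/-- The law of an i.i.d.-marked configuration does not depend on the enumeration of locations. -/
lemma infinitePi_zipMarks_eq [MeasurableSingletonClass S] (Q : Measure M) [IsProbabilityMeasure Q]
    {c c' : Set ℕ × (ℕ → S)} (h : pts c = pts c') {A : Set (Measure (S × M))}
    (hA : MeasurableSet A) :
    Measure.infinitePi (fun _ : ℕ => Q) {q | pts (zipMarks (c, q)) ∈ A} =
      Measure.infinitePi (fun _ : ℕ => Q) {q | pts (zipMarks (c', q)) ∈ A} := by
  obtain ⟨e, he⟩ := exists_equiv_of_pts_eq h
  have hG : ∀ c : Set ℕ × (ℕ → S), Measurable fun r : c.1 → M =>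
      (Measure.sum fun i : c.1 => Measure.dirac (c.2 i, r i) : Measure (S × M)) := by
    intro c
    refine Measure.measurable_of_measurable_coe _ fun B hB => ?_
    simp only [Measure.sum_apply _ hB]
    refine Measurable.tsum fun i => ?_
    exact (Measure.measurable_coe hB).comp (Measure.measurable_dirac.comp
      (measurable_const.prodMk (measurable_pi_apply i)))
  have hGA : ∀ c : Set ℕ × (ℕ → S), MeasurableSet {r : c.1 → M | (Measure.sum fun i : c.1 =>
      Measure.dirac (c.2 i, r i) : Measure (S × M)) ∈ A} := fun c => hG c hA
  -- Marks with indices outside `c.1` are not used and can be integrated out. The bijection `e` then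
  -- carries one product measure to the other.
  have hred : ∀ c : Set ℕ × (ℕ → S),
      Measure.infinitePi (fun _ : ℕ => Q) {q | pts (zipMarks (c, q)) ∈ A} =
      Measure.infinitePi (fun _ : c.1 => Q) {r | (Measure.sum fun i : c.1 =>
        Measure.dirac (c.2 i, r i) : Measure (S × M)) ∈ A} := by
    intro c
    rw [← Measure.infinitePi_map_restrict' (μ := fun _ : ℕ => Q) (I := c.1),
      Measure.map_apply (by fun_prop) (hGA c)]
    rfl
  rw [hred, hred, ← Measure.infinitePi_map_piCongrLeft (μ := fun _ : c'.1 => Q) e,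
    Measure.map_apply (MeasurableEquiv.measurable _) (hGA c')]
  congr 1
  ext r
  have : (Measure.sum fun j : c'.1 => Measure.dirac
      (c'.2 j, MeasurableEquiv.piCongrLeft (fun _ : c'.1 => M) e r j) : Measure (S × M)) =
      Measure.sum fun i : c.1 => Measure.dirac (c.2 i, r i) := by
    rw [← Measure.sum_comp_equiv e]
    congr 1
    funext i
    rw [Function.comp_apply, he i]
    congr 2
    exact MeasurableEquiv.piCongrLeft_apply_apply (β := fun _ : c'.1 => M) e r i
  simp only [mem_ofPred_eq, mem_preimage, this]

end Exchangeability

/-! ### Blackwell's theorem for location configurations -/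

section Determination

variable {d : ℕ} {M : Type*} [MeasurableSpace M]

/-- The enumerated configuration is locally finite. -/
def LocFin (c : Set ℕ × (ℕ → Loc d)) : Prop := ∀ n : ℕ, pts c (Metric.ball 0 n) < ∞

lemma measurableSet_locFin : MeasurableSet {c : Set ℕ × (ℕ → Loc d) | LocFin c} := by
  have : {c : Set ℕ × (ℕ → Loc d) | LocFin c} =
      ⋂ n : ℕ, {c | pts c (Metric.ball 0 n) < ∞} := by
    ext c; simp [LocFin]
  rw [this]
  exact MeasurableSet.iInter fun n =>
    ((Measure.measurable_coe measurableSet_ball).comp measurable_pts) measurableSet_Iio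

/-- A countable family of bounded sets determining locally finite measures. -/
lemma exists_determining_sets (d : ℕ) : ∃ B : Finset ℕ × ℕ → Set (Loc d),
    (∀ k, MeasurableSet (B k)) ∧ ∀ μ ν : Measure (Loc d),
      (∀ n : ℕ, μ (Metric.ball 0 n) < ∞) → (∀ k, μ (B k) = ν (B k)) → μ = ν := by
  obtain ⟨u, hu⟩ := (TopologicalSpace.countable_countableBasis (Loc d)).exists_eq_range
    (nonempty_iff_ne_empty.2 fun h => by
      have := (TopologicalSpace.isBasis_countableBasis (Loc d)).sUnion_eq
      rw [h, sUnion_empty] at this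
      exact empty_ne_univ this)
  have huo : ∀ k, IsOpen (u k) := fun k =>
    TopologicalSpace.isOpen_of_mem_countableBasis (hu ▸ mem_range_self k)
  have hm : ∀ s : Finset ℕ, MeasurableSet (⋂ k ∈ s, u k) := fun s =>
    s.measurableSet_biInter fun k _ => (huo k).measurableSet
  -- Finite intersections of basic open sets form a π-system generating the Borel sets; the balls
  -- keep masses finite, and the empty intersection yields the balls themselves.
  refine ⟨fun p => (⋂ k ∈ p.1, u k) ∩ Metric.ball 0 p.2, fun p => (hm p.1).inter
    measurableSet_ball, fun μ ν hμ h => ?_⟩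
  refine Measure.ext_of_generateFrom_of_cover (S := range fun s : Finset ℕ => ⋂ k ∈ s, u k)
    (T := range fun n : ℕ => Metric.ball (0 : Loc d) n) ?_ (countable_range _) ?_ ?_ ?_ ?_ ?_
  · refine le_antisymm ?_ (MeasurableSpace.generateFrom_le ?_)
    · rw [BorelSpace.measurable_eq (α := Loc d),
        (TopologicalSpace.isBasis_countableBasis (Loc d)).borel_eq_generateFrom]
      refine MeasurableSpace.generateFrom_mono ?_
      rw [hu]
      rintro _ ⟨k, rfl⟩
      exact ⟨{k}, by simp⟩
    · rintro _ ⟨s, rfl⟩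
      exact hm s
  · rintro _ ⟨s, rfl⟩ _ ⟨t, rfl⟩ _
    exact ⟨s ∪ t, by simp only [Finset.mem_union, iInter_or, iInter_inter_distrib]⟩
  · rw [sUnion_range, Metric.iUnion_ball_nat]
  · rintro _ ⟨n, rfl⟩
    exact (hμ n).ne
  · rintro _ ⟨n, rfl⟩ _ ⟨s, rfl⟩
    exact h (s, n)
  · rintro _ ⟨n, rfl⟩
    simpa using h (∅, n)

/-- An event which depends on an enumerated configuration only through the configuration is
an event in the space of configurations (Blackwell's theorem). -/
lemma exists_measurableSet_of_pts_invariant {E : Set (Set ℕ × (ℕ → Loc d))} (hE : MeasurableSet E)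
    (hinv : ∀ c c', pts c = pts c' → c ∈ E → c' ∈ E) :
    ∃ N : Set (Measure (Loc d)), MeasurableSet N ∧ ∀ c, LocFin c → (c ∈ E ↔ pts c ∈ N) := by
  obtain ⟨B, hB, hdet⟩ := exists_determining_sets d
  have hstd0 : StandardBorelSpace (Set ℕ) := inferInstanceAs (StandardBorelSpace (ℕ → Prop))
  have hstd : StandardBorelSpace {c : Set ℕ × (ℕ → Loc d) // LocFin c} :=
    measurableSet_locFin.standardBorel
  let f : {c : Set ℕ × (ℕ → Loc d) // LocFin c} → (Finset ℕ × ℕ → ℝ≥0∞) :=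
    fun c k => pts c.1 (B k)
  have hf : Measurable f := measurable_pi_lambda _ fun k =>
    (Measure.measurable_coe (hB k)).comp (measurable_pts.comp measurable_subtype_coe)
  -- By invariance the event is a union of fibres of `f`. On a standard Borel space such a
  -- measurable set is the preimage of a measurable set under `f`.
  have hpre : f ⁻¹' (f '' {c | c.1 ∈ E}) = {c | c.1 ∈ E} := by
    refine Subset.antisymm ?_ (subset_preimage_image _ _)
    rintro c ⟨c', hc', hcc⟩
    exact hinv _ _ (hdet _ _ c'.2 fun k => congrFun hcc k) hc'
  have hmeas : MeasurableSet (f ⁻¹' (f '' {c | c.1 ∈ E})) := by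
    rw [hpre]
    exact measurable_subtype_coe hE
  obtain ⟨N', hN', hNe⟩ := (hf.measurableSet_preimage_iff_preimage_val).1 hmeas
  refine ⟨{ξ | (fun k => ξ (B k)) ∈ N'},
    (measurable_pi_lambda _ fun k => Measure.measurable_coe (hB k)) hN', fun c hc => ?_⟩
  have h1 : (⟨f ⟨c, hc⟩, mem_range_self _⟩ : range f) ∈ ((↑) ⁻¹' N' : Set (range f)) ↔
      f ⟨c, hc⟩ ∈ f '' {c | c.1 ∈ E} := by
    rw [hNe]; rfl
  have h2 : f ⟨c, hc⟩ ∈ f '' {c | c.1 ∈ E} ↔ c ∈ E := by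
    have : (⟨c, hc⟩ : {c // LocFin c}) ∈ f ⁻¹' (f '' {c | c.1 ∈ E}) ↔
      (⟨c, hc⟩ : {c // LocFin c}) ∈ {c : {c // LocFin c} | c.1 ∈ E} := by rw [hpre]
    exact this
  exact (h1.trans h2).symm

end Determination

/-! ### Deletion tolerance of marked Cox processes -/

section CoxMarked

variable {d : ℕ} {M Ω : Type*} [MeasurableSpace M] [MeasurableSpace Ω]

lemma LocFin.delIdx {c : Set ℕ × (ℕ → Loc d)} (hc : LocFin c) {i : ℕ} (hi : i ∈ c.1) :
    LocFin (delIdx i c) := by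
  intro n
  refine lt_of_le_of_lt ?_ (hc n)
  rw [pts_eq_delIdx_add hi, Measure.add_apply]
  exact le_self_add

theorem IsIIDMarkedCox.deletionTolerant {P : Measure Ω} {X : Ω → Measure (Loc d × M)}
    (hX : IsIIDMarkedCox P X) : DeletionTolerant P X := by
  obtain ⟨hpp, ⟨Q, ρ, hQ, hρ, hlaw⟩, θ, hθp, hθ, hcox⟩ := hX
  have hatt : Measurable fun c : (Set ℕ × (ℕ → Loc d)) × (ℕ → M) => pts (zipMarks c) :=
    measurable_pts.comp measurable_zipMarks
  have hlaw' : P.map X = (ρ.prod (Measure.infinitePi fun _ : ℕ => Q)).map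
      fun c => pts (zipMarks c) := hlaw
  have hfst : Measurable fun ξ : Measure (Loc d × M) => ξ.map Prod.fst :=
    Measure.measurable_map _ measurable_fst
  have hloc : ∀ E : Set (Measure (Loc d)), MeasurableSet E →
      P {ω | (X ω).map Prod.fst ∈ E} = ρ.map pts E := by
    intro E hE
    have hE' : MeasurableSet {ξ : Measure (Loc d × M) | ξ.map Prod.fst ∈ E} := hfst hE
    have h1 : P {ω | (X ω).map Prod.fst ∈ E} = P.map X {ξ | ξ.map Prod.fst ∈ E} :=
      (Measure.map_apply hpp.1 hE').symm
    rw [h1, hlaw', Measure.map_apply hatt hE', Measure.map_apply measurable_pts hE]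
    have h2 : (fun c : (Set ℕ × (ℕ → Loc d)) × (ℕ → M) => pts (zipMarks c)) ⁻¹'
        {ξ | ξ.map Prod.fst ∈ E} = (pts ⁻¹' E) ×ˢ univ := by
      ext c
      simp [map_fst_pts_zipMarks]
    rw [h2, Measure.prod_prod, measure_univ, mul_one]
  have hcox' : ∀ Λ : Set (Loc d), Bornology.IsBounded Λ → MeasurableSet Λ →
      ∀ A : Set (Measure (Loc d)), MeasurableSet A →
        ρ.map pts {ξ | ξ.restrict Λ ∈ A} = ∫⁻ γ, poissonLaw (γ.restrict Λ) A ∂θ := by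
    intro Λ hb hΛ A hA
    rw [← hcox Λ hb hΛ A hA]
    exact (hloc _ (measurable_restrict_set hΛ hA)).symm
  have hlf : ∀ᵐ c ∂ρ, LocFin c := by
    simp only [LocFin, ae_all_iff]
    intro n
    have hE : MeasurableSet {ξ : Measure (Loc d) | ¬ ξ (Metric.ball 0 n) < ∞} :=
      ((Measure.measurable_coe measurableSet_ball) measurableSet_Iio).compl
    have h0 : ρ.map pts {ξ : Measure (Loc d) | ¬ ξ (Metric.ball 0 n) < ∞} = 0 := by
      rw [← hloc _ hE, ← nonpos_iff_eq_zero, ← ae_iff.1 hpp.2]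
      refine measure_mono fun ω hω hc => hω ?_
      rw [Measure.map_apply measurable_fst measurableSet_ball, ← prod_univ]
      exact hc.2 _ Metric.isBounded_ball
    rw [Measure.map_apply measurable_pts hE] at h0
    exact h0
  refine deletionTolerant_of_delMass hpp fun A hA hPA n => ?_
  set E : Set (Measure (Loc d × M)) := evalMap ⁻¹' A with hEdef
  have hE : MeasurableSet E := measurable_evalMap hA
  have hΦ : Measurable fun c : Set ℕ × (ℕ → Loc d) =>
      Measure.infinitePi (fun _ : ℕ => Q) {q | pts (zipMarks (c, q)) ∈ E} :=
    measurable_measure_prodMk_left (hatt hE)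
  -- `N` consists, up to local finiteness, of the location configurations whose i.i.d. marking falls
  -- into `E` with positive probability.
  obtain ⟨N, hN, hNE⟩ := exists_measurableSet_of_pts_invariant
    (hΦ (measurableSet_singleton 0).compl) fun c c' h hc => by
      rw [mem_preimage, ← infinitePi_zipMarks_eq Q h hE]
      exact hc
  have hN0 : ρ.map pts N = 0 := by
    rw [Measure.map_apply measurable_pts hN, measure_eq_zero_iff_ae_notMem]
    have h1 : (ρ.prod (Measure.infinitePi fun _ : ℕ => Q)) {c | pts (zipMarks c) ∈ E} = 0 := by
      have h2 := Measure.map_apply (μ := P) hpp.1 hE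
      rw [hlaw', Measure.map_apply hatt hE] at h2
      exact h2.trans hPA
    filter_upwards [Measure.measure_ae_null_of_prod_null h1, hlf] with c hc hcf hcN
    exact (hNE c hcf).2 hcN hc
  have hdel := ae_delIdx_notMem (measurableSet_ball (x := (0 : Loc d)) (ε := n))
    (hlf.mono fun c hc => (hc n).ne) hN (delLaw_eq_zero_of_cox hθ hcox' n hN hN0)
  have hDm := measurable_delMass (measurableSet_cyl (M := M) (d := d) n) hA
  have hset : MeasurableSet {ξ : Measure (Loc d × M) |
      delMass (measurableSet_cyl (M := M) (d := d) n) A ξ = 0} := hDm (measurableSet_singleton 0)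
  refine (ae_map_iff hpp.1.aemeasurable hset).1 ?_
  rw [hlaw', ae_map_iff hatt.aemeasurable hset]
  refine (Measure.ae_prod_iff_ae_ae (hatt hset)).2 ?_
  filter_upwards [hlf, hdel] with c hcf hcd
  -- Deleting index `i` leaves the sequence `q` untouched, so the same i.i.d. marks serve the
  -- reduced configuration, which lies outside `N`.
  have hq : ∀ᵐ q ∂Measure.infinitePi fun _ : ℕ => Q, ∀ i, i ∈ c.1 → c.2 i ∈ Metric.ball 0 n →
      pts (zipMarks (delIdx i c, q)) ∉ E := by
    rw [ae_all_iff]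
    intro i
    by_cases hi : i ∈ c.1 ∧ c.2 i ∈ Metric.ball 0 n
    · have h3 := (hNE _ (hcf.delIdx hi.1)).not.2 (hcd i hi.1 hi.2)
      simp only [mem_preimage, mem_compl_iff, mem_singleton_iff, not_not] at h3
      exact (measure_eq_zero_iff_ae_notMem.1 h3).mono fun q hq _ _ => hq
    · exact Eventually.of_forall fun q h1 h2 => absurd ⟨h1, h2⟩ hi
  filter_upwards [hq] with q hq
  rw [delMass_pts _ hA, ENNReal.tsum_eq_zero]
  intro i
  by_cases hi : i ∈ c.1
  · by_cases hb : c.2 i ∈ Metric.ball 0 n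
    · have : pts (delIdx i (zipMarks (c, q))) ∉ evalMap ⁻¹' A := hq i hi hb
      rw [indicator_of_notMem this, mul_zero]
    · have : (c.2 i, q i) ∉ cyl d M n := fun h => hb h.1
      simp [delWeight, zipMarks, this]
  · simp [delWeight, zipMarks, hi]

end CoxMarked

end PointProc

end

theorem proposition2p6 {d : ℕ} (hd : 0 < d) {M Ω : Type*} [MeasurableSpace M] [MeasurableSpace Ω]
    (P : Measure Ω) [IsProbabilityMeasure P] (X : Ω → Measure (PointProc.Loc d × M)) :
    (PointProc.IsIIDMarkedCox P X → PointProc.DeletionTolerant P X) ∧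
    (∀ [TopologicalSpace M] [PolishSpace M] [BorelSpace M]
      (H : PointProc.Hamiltonian d M) (lam : ℝ≥0) (Q : Measure M) [IsProbabilityMeasure Q],
      0 < lam → PointProc.IsGibbs P X H lam Q →
      (∀ Λ : Set (PointProc.Loc d), Bornology.IsBounded Λ → MeasurableSet Λ →
        ∀ᵐ ω ∂P, PointProc.partitionFunction H lam Q Λ (X ω) < ∞) →
      PointProc.DeletionTolerant P X) :=
  ⟨fun hX => hX.deletionTolerant, fun _ _ _ _ _ hX hZ => hX.deletionTolerant hd hZ⟩
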